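/- Let $n\ge 0$. A graded poset $P$ of rank $n+1$ is a finite poset with minimum $\hat 0$, maximum $\hat 1$ and a rank function $\rho$ with $\rho(\hat 0)=0$, $\rho(\hat 1)=n+1$ and $\rho(y)=\rho(x)+1$ whenever $y$ covers $x$. It is Eulerian if $\mu([x,y])=(-1)^{\rho(y)-\rho(x)}$ for every interval $[x,y]$ of $P$, where $\mu$ is the Möbius function. For $S\subseteq[1,n]=\{1,\dots,n\}$ let $f_S(P)$ be the number of chains in $P$ whose set of ranks is $S$, and put $$L_S(P)=(-1)^{n-|S|}\sum_{[1,n]\setminus S\,\subseteq\, T\,\subseteq\,[1,n]}\left(-\tfrac12\right)^{|T|}f_T(P).$$ Let $\mathcal C_{\mathcal E}^{n+1}\subseteq\mathbb R^{2^n}$ be the closed convex cone generated by the flag vectors $(f_S(P))_{S\subseteq[1,n]}$ of all Eulerian posets $P$ of rank $n+1$; each $L_S$ is regarded as a linear form on $\mathbb R^{2^n}$. A linear inequality determines a facet of the cone if it holds on the whole cone and the points of the cone where equality holds form a face of dimension one less than that of the cone. For a finite set $S$ of integers let $\mathcal I[S]$ be the set of maximal (nonempty) intervals $[a,b]$ of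 integers contained in $S$. Let $V\subseteq[1,n]$ be such that every $I\in\mathcal I[V]$ has at least $2$ elements and every $I\in\mathcal I[[0,n+1]\setminus V]$ has at most $3$ elements. Let $M\subseteq V$ be such that every $[a,b]\in\mathcal I[V]$ satisfies (i) $M\cap[a,b]=\emptyset$, $[a,a+1]$ or $[b-1,b]$; (ii) if $a\notin M$ then $a-2\in\{-1\}\cup M$; (iii) if $b\notin M$ then $b+2\in\{n+2\}\cup M$. Then $$(-1)^{|M|/2}\sum_{M\subseteq Q\subseteq V}L_Q(P)\ \ge\ 0$$ holds for every Eulerian poset $P$ of rank $n+1$ and determines a facet of $\mathcal C_{\mathcal E}^{n+1}$. Furthermore, if two distinct pairs $(M,V)$ and $(M',V')$ both satisfy these conditions and also the requirement that $M\cap[a,a+2]=\emptyset$ for every $[a,a+2]\in\mathcal I[V]$ (respectively $M'\cap[a,a+2]=\emptyset$ for every $[a,a+2]\in\mathcal I[V']$), then the facets that they determine are distinct. -/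

import Mathlib

/-- The number `f_S(P)` of chains of `P` whose set of ranks is exactly `S`.  Ranks in a chain are
distinct, so such a chain has `|S|` elements. -/
noncomputable def flagF (P : Type*) [PartialOrder P] [GradeMinOrder ℕ P] (S : Finset ℕ) : ℕ :=
  Set.ncard {c : Finset P | IsChain (· < ·) (c : Set P) ∧ c.image (grade ℕ) = S}

open Classical in
/-- A finite graded poset is Eulerian if the Möbius function of every interval `[x, y]` equals
`(-1) ^ (ρ y - ρ x)`.  The rank function `ρ` is `grade ℕ`. -/
def IsEulerian (P : Type*) [PartialOrder P] [Fintype P] [GradeMinOrder ℕ P] : Prop :=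
  letI : LocallyFiniteOrder P := Fintype.toLocallyFiniteOrder
  ∀ x y : P, x ≤ y →
    IncidenceAlgebra.mu ℤ x y = (-1 : ℤ) ^ (grade ℕ y - grade ℕ x)

/-- The space `ℝ^(2^n)` with one coordinate for every subset `S` of `[1, n]`. -/
abbrev FlagSpace (n : ℕ) : Type := ↥((Finset.Icc 1 n).powerset) → ℝ

/-- The flag `f`-vector `(f_S(P) : S ⊆ [1, n])` of a graded poset `P` of rank `n + 1`. -/
noncomputable def flagVector (n : ℕ) (P : Type*) [PartialOrder P] [GradeMinOrder ℕ P] :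
    FlagSpace n :=
  fun S => (flagF P (S : Finset ℕ) : ℝ)

/-- The set of flag `f`-vectors of all Eulerian posets of rank `n + 1`.  Posets in `Type` suffice,
since every finite poset is isomorphic to one of these. -/
def eulerianFlagVectors (n : ℕ) : Set (FlagSpace n) :=
  {x | ∃ (P : Type) (_ : PartialOrder P) (_ : Fintype P) (_ : BoundedOrder P)
      (_ : GradeMinOrder ℕ P),
      grade ℕ (⊤ : P) = n + 1 ∧ IsEulerian P ∧ x = flagVector n P}

/-- The Eulerian cone of rank `n + 1`: the closed convex cone generated by the flag `f`-vectors of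
all Eulerian posets of rank `n + 1`. -/
def eulerianCone (n : ℕ) : Set (FlagSpace n) :=
  closure (PointedCone.hull ℝ (eulerianFlagVectors n) : Set (FlagSpace n))

/-- The flag `L`-vector, as a linear function of the flag `f`-vector `x`:
`L_S = (-1)^(n - |S|) ∑_{[1,n] \ S ⊆ T ⊆ [1,n]} (-1/2)^|T| x_T`. -/
noncomputable def flagL (n : ℕ) (S : Finset ℕ) (x : FlagSpace n) : ℝ :=
  (-1) ^ (n - S.card) *
    ∑ T : ↥((Finset.Icc 1 n).powerset),
      if Finset.Icc 1 n \ S ⊆ T.1 then (-1 / 2 : ℝ) ^ T.1.card * x T else 0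

/-- The interval `[a, b]` belongs to the interval system of `S`: it is a nonempty interval of
integers contained in `S` and maximal among those. -/
def IsMaxInterval (S : Finset ℕ) (a b : ℕ) : Prop :=
  a ≤ b ∧ Finset.Icc a b ⊆ S ∧
    ∀ c d : ℕ, c ≤ a → b ≤ d → Finset.Icc c d ⊆ S → c = a ∧ d = b

/-- The conditions on a pair `(M, V)` of subsets of `[1, n]`. -/
structure IsFacetPair (n : ℕ) (M V : Finset ℕ) : Prop where
  subset_range : V ⊆ Finset.Icc 1 n
  subset : M ⊆ V
  two_le_card : ∀ a b, IsMaxInterval V a b → 2 ≤ (Finset.Icc a b).card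
  gap_card_le : ∀ a b, IsMaxInterval (Finset.Icc 0 (n + 1) \ V) a b → (Finset.Icc a b).card ≤ 3
  /-- condition (i) -/
  inter : ∀ a b, IsMaxInterval V a b →
    M ∩ Finset.Icc a b = ∅ ∨ M ∩ Finset.Icc a b = Finset.Icc a (a + 1) ∨
      M ∩ Finset.Icc a b = Finset.Icc (b - 1) b
  /-- condition (ii): if `a ∉ M` then `a - 2 ∈ {-1} ∪ M` -/
  left : ∀ a b, IsMaxInterval V a b → a ∉ M → a = 1 ∨ ∃ m ∈ M, a = m + 2
  /-- condition (iii): if `b ∉ M` then `b + 2 ∈ {n + 2} ∪ M` -/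
  right : ∀ a b, IsMaxInterval V a b → b ∉ M → b + 2 = n + 2 ∨ b + 2 ∈ M

/-- The additional requirement on `(M, V)`: `M` misses every maximal interval of `V` that has
exactly three elements. -/
def AvoidsTriples (M V : Finset ℕ) : Prop :=
  ∀ a, IsMaxInterval V a (a + 2) → M ∩ Finset.Icc a (a + 2) = ∅

/-- The linear form `(-1)^(|M|/2) ∑_{M ⊆ Q ⊆ V} L_Q`. -/
noncomputable def facetForm (n : ℕ) (M V : Finset ℕ) (x : FlagSpace n) : ℝ :=
  (-1) ^ (M.card / 2) * ∑ Q ∈ V.powerset with M ⊆ Q, flagL n Q x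

/-- `F` is a facet of the convex set `C`: a nonempty face (convex extreme subset) whose dimension
is one less than that of `C`. -/
structure IsFacet {E : Type*} [AddCommGroup E] [Module ℝ E] (C F : Set E) : Prop where
  nonempty : F.Nonempty
  convex : Convex ℝ F
  isExtreme : IsExtreme ℝ C F
  finrank_add_one : Module.finrank ℝ (vectorSpan ℝ F) + 1 = Module.finrank ℝ (vectorSpan ℝ C)

/-- The points of the Eulerian cone at which the inequality of `(M, V)` is an equality. -/
def facetOf (n : ℕ) (M V : Finset ℕ) : Set (FlagSpace n) :=
  {x ∈ eulerianCone n | facetForm n M V x = 0}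

/-!
For a graded poset of rank `n + 1` put `S = [1, n] \ V`.  Up to a positive factor, the form of the
pair `(M, V)` is `(-1)^(|M|/2) ∑_{U ⊆ M} (-1/2)^|U| f_{S ∪ U}`, a sum over the chains with rank set
`S` in which each interval of `V` contributes a local factor: `1` if it does not meet `M`, and
otherwise `f_1/2 - 1`, where `f_1` counts the atoms (or the coatoms) of an interval of the poset.
Indeed rank-two intervals of an Eulerian poset have two middle elements, which eliminates the flag
numbers of two adjacent ranks, and longer intervals have at least two atoms and two coatoms; so the
form is nonnegative (`IsFacetPair.wordForm_nonneg`).  The local factors are obtained by evaluating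
forms with a product structure (`wordForm`) by a product of operators, one for each rank
(`transfer`).

The vectors `E_W` dual to the `L`-numbers (`dualVector`) form a basis.  The `L`-numbers of an
Eulerian poset vanish on sets with a maximal interval of odd cardinality
(`IsEulerian.flagL_eq_zero`), so the cone lies in the span of the `E_W` with `W` even
(`evenSpace`), and the form of `(M, V)` takes on `E_W` the value `±1` if `M ⊆ W ⊆ V` and `0`
otherwise.

Conversely, for a system of disjoint even intervals, multiply these intervals of ranks in the poset
with two elements in each rank `1, …, n`.  The result is Eulerian, and its normalized flag vectors
converge to `∑_J (-1)^|J| E_{⋃ J}`, the sum over all subsystems `J`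
(`BlockSystem.limitVector_mem_eulerianCone`, `BlockSystem.limitVector_eq_sum`).  Letting the system
run over decompositions of the even sets gives a triangular family, so the cone spans `evenSpace`.
For each even `S ≠ M` the decomposition can be chosen such that the form of `(M, V)` vanishes
(`IsFacetPair.exists_blockSystem`): for `S ⊆ V` into pairs, one of which avoids `M`, and otherwise
into maximal intervals, where the conditions on the gaps of `V` are used.  Hence the facet spans the
hyperplane of the form in `evenSpace` (`IsFacetPair.span_facetOf`).  Finally the facet determines
the even sets between `M` and `V`; their intersection is `M`, and their union is `V` if `M` avoids
the intervals of `V` with three elements.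
-/

/-! ### The Euler relation -/

open Classical in
theorem IsEulerian.sum_neg_one_pow_grade {P : Type*} [PartialOrder P] [Fintype P]
    [GradeMinOrder ℕ P] (hE : IsEulerian P) {x y : P} (h : x < y) :
    ∑ z with x ≤ z ∧ z ≤ y, (-1 : ℝ) ^ grade ℕ z = 0 := by
  let _ : LocallyFiniteOrder P := Fintype.toLocallyFiniteOrder
  have h1 := IncidenceAlgebra.sum_Icc_mu_right (𝕜 := ℤ) x y
  rw [if_neg h.ne] at h1
  have h2 : ∑ z ∈ Finset.Icc x y, (-1 : ℤ) ^ (grade ℕ z - grade ℕ x) = 0 := by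
    rw [← h1]
    refine Finset.sum_congr rfl fun z hz => ?_
    exact (hE x z (Finset.mem_Icc.1 hz).1).symm
  have h3 : (Finset.univ.filter fun z => x ≤ z ∧ z ≤ y) = Finset.Icc x y := by
    ext z; simp [Finset.mem_Icc]
  rw [h3]
  have h4 : ∀ z ∈ Finset.Icc x y, (-1 : ℝ) ^ grade ℕ z =
      (-1) ^ grade ℕ x * (((-1 : ℤ) ^ (grade ℕ z - grade ℕ x) : ℤ) : ℝ) := by
    intro z hz
    have : grade ℕ x ≤ grade ℕ z := grade_mono (Finset.mem_Icc.1 hz).1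
    push_cast
    rw [← pow_add]
    congr 1
    omega
  rw [Finset.sum_congr rfl h4, ← Finset.mul_sum, ← Int.cast_sum, h2]
  simp

open Classical in
theorem isEulerian_of_sum_neg_one_pow_grade {P : Type*} [PartialOrder P] [Fintype P]
    [GradeMinOrder ℕ P]
    (h : ∀ x y : P, x < y → ∑ z with x ≤ z ∧ z ≤ y, (-1 : ℤ) ^ grade ℕ z = 0) :
    IsEulerian P := by
  let _ : LocallyFiniteOrder P := Fintype.toLocallyFiniteOrder
  intro x
  -- induction on the rank of the upper end of the interval
  suffices H : ∀ k : ℕ, ∀ y : P, grade ℕ y = k → x ≤ y →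
      IncidenceAlgebra.mu ℤ x y = (-1 : ℤ) ^ (grade ℕ y - grade ℕ x) from
    fun y hxy => H _ y rfl hxy
  intro k
  induction k using Nat.strong_induction_on with
  | _ k ih =>
    intro y hk hxy
    rcases hxy.eq_or_lt with rfl | hlt
    · simp
    have h1 := IncidenceAlgebra.sum_Icc_mu_right (𝕜 := ℤ) x y
    rw [if_neg hlt.ne] at h1
    have h3 : (Finset.univ.filter fun z => x ≤ z ∧ z ≤ y) = Finset.Icc x y := by
      ext z; simp [Finset.mem_Icc]
    have h2 := h x y hlt
    rw [h3] at h2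
    have h4 : ∑ z ∈ Finset.Icc x y, (-1 : ℤ) ^ (grade ℕ z - grade ℕ x) = 0 := by
      have : ∀ z ∈ Finset.Icc x y, (-1 : ℤ) ^ grade ℕ z =
          (-1) ^ grade ℕ x * (-1 : ℤ) ^ (grade ℕ z - grade ℕ x) := by
        intro z hz
        have : grade ℕ x ≤ grade ℕ z := grade_mono (Finset.mem_Icc.1 hz).1
        rw [← pow_add]
        congr 1
        omega
      rw [Finset.sum_congr rfl this, ← Finset.mul_sum] at h2
      exact (mul_eq_zero.1 h2).resolve_left (by simp)
    have hy : y ∈ Finset.Icc x y := Finset.mem_Icc.2 ⟨hxy, le_rfl⟩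
    rw [← Finset.add_sum_erase _ _ hy] at h1 h4
    have h5 : ∑ z ∈ (Finset.Icc x y).erase y, IncidenceAlgebra.mu ℤ x z =
        ∑ z ∈ (Finset.Icc x y).erase y, (-1 : ℤ) ^ (grade ℕ z - grade ℕ x) := by
      refine Finset.sum_congr rfl fun z hz => ?_
      rw [Finset.mem_erase, Finset.mem_Icc] at hz
      exact ih (grade ℕ z) (hk ▸ grade_strictMono (lt_of_le_of_ne hz.2.2 hz.1)) z rfl hz.2.1
    rw [h5] at h1
    linarith

/-! ### Counting chains -/

open Classical in
/-- The number of chains with rank set `T` all of whose elements are smaller than `y`. -/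
noncomputable def chainsBelow {P : Type*} [PartialOrder P] [Fintype P] [GradeMinOrder ℕ P]
    (T : Finset ℕ) (y : P) : ℕ :=
  (Finset.univ.filter fun c : Finset P =>
    IsChain (· < ·) (c : Set P) ∧ c.image (grade ℕ) = T ∧ ∀ z ∈ c, z < y).card

theorem chainsBelow_empty {P : Type*} [PartialOrder P] [Fintype P] [GradeMinOrder ℕ P] (y : P) :
    chainsBelow ∅ y = 1 := by
  classical
  rw [chainsBelow, Finset.card_eq_one]
  refine ⟨∅, ?_⟩
  ext c
  simp only [Finset.mem_filter, Finset.mem_univ, true_and, Finset.image_eq_empty,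
    Finset.mem_singleton]
  constructor
  · exact fun h => h.2.1
  · rintro rfl
    simp

open Classical in
/-- A chain whose largest rank is `j` is an element `z` of rank `j` together with a chain
below `z`. -/
theorem chainsBelow_insert {P : Type*} [PartialOrder P] [Fintype P] [GradeMinOrder ℕ P]
    {T : Finset ℕ} {j : ℕ} (hT : ∀ t ∈ T, t < j) (y : P) :
    chainsBelow (insert j T) y = ∑ z with z < y ∧ grade ℕ z = j, chainsBelow T z := by
  have hnot : ∀ (z : P) (c : Finset P), (∀ w ∈ c, w < z) → z ∉ c :=
    fun z c hc hz => lt_irrefl _ (hc z hz)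
  have key : (Finset.univ.filter fun c : Finset P =>
      IsChain (· < ·) (c : Set P) ∧ c.image (grade ℕ) = insert j T ∧ ∀ z ∈ c, z < y) =
      (Finset.univ.filter fun z : P => z < y ∧ grade ℕ z = j).biUnion fun z =>
        (Finset.univ.filter fun c : Finset P =>
          IsChain (· < ·) (c : Set P) ∧ c.image (grade ℕ) = T ∧ ∀ w ∈ c, w < z).image
            (insert z) := by
    ext c
    simp only [Finset.mem_filter, Finset.mem_univ, true_and, Finset.mem_biUnion, Finset.mem_image]
    constructor
    · rintro ⟨hc, him, hy⟩
      obtain ⟨z, hzc, hzj⟩ : ∃ z ∈ c, grade ℕ z = j := by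
        have : j ∈ c.image (grade ℕ) := him ▸ Finset.mem_insert_self _ _
        simpa using this
      have hlt : ∀ w ∈ c.erase z, w < z := by
        intro w hw
        rw [Finset.mem_erase] at hw
        rcases hc (Finset.mem_coe.2 hw.2) (Finset.mem_coe.2 hzc) hw.1 with h | h
        · exact h
        · exfalso
          have h1 : grade ℕ z < grade ℕ w := grade_strictMono h
          have h2 : grade ℕ w ∈ insert j T := him ▸ Finset.mem_image_of_mem _ hw.2
          rcases Finset.mem_insert.1 h2 with h3 | h3
          · omega
          · have := hT _ h3; omega
      refine ⟨z, ⟨hy z hzc, hzj⟩, c.erase z, ⟨hc.mono (by simp), ?_, hlt⟩,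
        Finset.insert_erase hzc⟩
      ext t
      simp only [Finset.mem_image]
      constructor
      · rintro ⟨w, hw, rfl⟩
        have h1 : grade ℕ w < grade ℕ z := grade_strictMono (hlt w hw)
        have h2 : grade ℕ w ∈ insert j T :=
          him ▸ Finset.mem_image_of_mem _ (Finset.mem_of_mem_erase hw)
        rcases Finset.mem_insert.1 h2 with h3 | h3
        · omega
        · exact h3
      · intro ht
        have h2 : t ∈ c.image (grade ℕ) := him ▸ Finset.mem_insert_of_mem ht
        obtain ⟨w, hw, rfl⟩ := Finset.mem_image.1 h2
        refine ⟨w, Finset.mem_erase.2 ⟨?_, hw⟩, rfl⟩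
        rintro rfl
        have := hT _ ht
        omega
    · rintro ⟨z, ⟨hzy, hzj⟩, d, ⟨hd, him, hlt⟩, rfl⟩
      refine ⟨?_, ?_, ?_⟩
      · rw [Finset.coe_insert]
        exact hd.insert fun w hw _ => Or.inr (hlt w hw)
      · rw [Finset.image_insert, him, hzj]
      · intro w hw
        rcases Finset.mem_insert.1 hw with rfl | hw
        · exact hzy
        · exact (hlt w hw).trans hzy
  rw [chainsBelow, key, Finset.card_biUnion]
  · refine Finset.sum_congr rfl fun z _ => ?_
    rw [Finset.card_image_of_injOn, chainsBelow]
    intro c hc d hd hcd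
    simp only [Finset.coe_filter, Finset.mem_univ, true_and, Set.mem_ofPred_eq] at hc hd
    rw [← Finset.erase_insert (hnot z c hc.2.2), hcd, Finset.erase_insert (hnot z d hd.2.2)]
  · intro z hz w hw hzw
    rw [Function.onFun, Finset.disjoint_left]
    intro c hc hc'
    simp only [Finset.coe_filter, Finset.mem_univ, true_and, Set.mem_ofPred_eq,
      Finset.mem_image, Finset.mem_filter] at hz hw hc hc'
    obtain ⟨d, hd, rfl⟩ := hc
    obtain ⟨e, he, heq⟩ := hc'
    have h1 : z ∈ insert w e := heq ▸ Finset.mem_insert_self _ _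
    rcases Finset.mem_insert.1 h1 with h2 | h2
    · exact hzw h2
    · have := hT (grade ℕ z) (he.2.1 ▸ Finset.mem_image_of_mem _ h2)
      omega

theorem flagF_eq_chainsBelow_top {P : Type*} [PartialOrder P] [Fintype P] [BoundedOrder P]
    [GradeMinOrder ℕ P] {n : ℕ} (hP : grade ℕ (⊤ : P) = n + 1) {T : Finset ℕ}
    (hT : T ⊆ Finset.Icc 1 n) : flagF P T = chainsBelow T (⊤ : P) := by
  classical
  rw [flagF, chainsBelow, ← Set.ncard_coe_finset]
  congr 1
  ext c
  simp only [Set.mem_ofPred_eq, Finset.coe_filter, Finset.mem_univ, true_and]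
  refine ⟨fun h => ⟨h.1, h.2, fun z hz => lt_top_iff_ne_top.2 ?_⟩, fun h => ⟨h.1, h.2.1⟩⟩
  rintro rfl
  have := Finset.mem_Icc.1 (hT (h.2 ▸ Finset.mem_image_of_mem _ hz))
  omega

/-! ### Word forms and their evaluation by transfer operators -/

/-- The linear form `∑_T (∏_{i ∉ T} α i) (∏_{i ∈ T} β i) x_T`.  It is the product of the
one-letter forms `α i + β i · [i ∈ T]`, and all linear forms of interest are of this kind. -/
noncomputable def wordForm (n : ℕ) (α β : ℕ → ℝ) (x : FlagSpace n) : ℝ :=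
  ∑ T : ↥((Finset.Icc 1 n).powerset),
    (∏ i ∈ Finset.Icc 1 n \ T.1, α i) * (∏ i ∈ T.1, β i) * x T

open Classical in
/-- The value at `y` of the word form with letters `α i`, `β i`, `i ≤ k`, on chains below `y`. -/
noncomputable def transfer {P : Type*} [PartialOrder P] [Fintype P] [GradeMinOrder ℕ P]
    (α β : ℕ → ℝ) : ℕ → P → ℝ
  | 0 => fun _ => 1
  | k + 1 => fun y => α (k + 1) * transfer α β k y +
      β (k + 1) * ∑ z with z < y ∧ grade ℕ z = k + 1, transfer α β k z

theorem transfer_eq_sum {P : Type*} [PartialOrder P] [Fintype P] [GradeMinOrder ℕ P]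
    (α β : ℕ → ℝ) (k : ℕ) (y : P) :
    transfer α β k y = ∑ T ∈ (Finset.Icc 1 k).powerset,
      (∏ i ∈ Finset.Icc 1 k \ T, α i) * (∏ i ∈ T, β i) * (chainsBelow T y : ℝ) := by
  classical
  induction k generalizing y with
  | zero => simp [transfer, chainsBelow_empty]
  | succ k ih =>
    have hk : k + 1 ∉ Finset.Icc 1 k := by simp
    have hI : Finset.Icc 1 (k + 1) = insert (k + 1) (Finset.Icc 1 k) := by
      ext i; simp only [Finset.mem_Icc, Finset.mem_insert]; omega
    simp only [transfer]
    rw [hI, Finset.sum_powerset_insert hk]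
    congr 1
    · rw [ih, Finset.mul_sum]
      refine Finset.sum_congr rfl fun T hT => ?_
      have hkT : k + 1 ∉ T := fun h => hk (Finset.mem_powerset.1 hT h)
      rw [Finset.insert_sdiff_of_notMem _ hkT, Finset.prod_insert (by simp)]
      ring
    · simp only [ih]
      rw [Finset.sum_comm, Finset.mul_sum]
      refine Finset.sum_congr rfl fun T hT => ?_
      have hkT : k + 1 ∉ T := fun h => hk (Finset.mem_powerset.1 hT h)
      rw [chainsBelow_insert, Finset.prod_insert hkT, Finset.insert_sdiff_insert,
        Finset.sdiff_insert_of_notMem hk]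
      · push_cast
        rw [Finset.mul_sum, Finset.mul_sum]
        refine Finset.sum_congr rfl fun z _ => ?_
        ring
      · intro t ht
        have := Finset.mem_Icc.1 (Finset.mem_powerset.1 hT ht)
        omega

theorem wordForm_flagVector {P : Type*} [PartialOrder P] [Fintype P] [BoundedOrder P]
    [GradeMinOrder ℕ P] {n : ℕ} (hP : grade ℕ (⊤ : P) = n + 1) (α β : ℕ → ℝ) :
    wordForm n α β (flagVector n P) = transfer α β n (⊤ : P) := by
  rw [transfer_eq_sum, ← Finset.sum_coe_sort (Finset.Icc 1 n).powerset]
  refine Finset.sum_congr rfl fun T _ => ?_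
  rw [flagVector, flagF_eq_chainsBelow_top hP (Finset.mem_powerset.1 T.2)]

/-! ### Small intervals of Eulerian posets -/

theorem exists_grade_succ_le {P : Type*} [PartialOrder P] [Fintype P] [GradeMinOrder ℕ P]
    {x y : P} (h : x < y) : ∃ w, x < w ∧ w ≤ y ∧ grade ℕ w = grade ℕ x + 1 := by
  obtain ⟨w, hw, hwy⟩ := exists_covBy_le_of_lt h
  have := Nat.covBy_iff_add_one_eq.1 (hw.grade ℕ)
  exact ⟨w, hw.lt, hwy, this.symm⟩

theorem exists_le_grade_succ {P : Type*} [PartialOrder P] [Fintype P] [GradeMinOrder ℕ P]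
    {x y : P} (h : x < y) : ∃ w, x ≤ w ∧ w < y ∧ grade ℕ y = grade ℕ w + 1 := by
  obtain ⟨w, hxw, hw⟩ := exists_le_covBy_of_lt h
  have := Nat.covBy_iff_add_one_eq.1 (hw.grade ℕ)
  exact ⟨w, hxw, hw.lt, this.symm⟩

open Classical in
/-- If there were only one atom `w`, the Euler relations of `[x, y]` and `[w, y]` would be
incompatible. -/
theorem IsEulerian.two_le_card_atoms {P : Type*} [PartialOrder P] [Fintype P]
    [GradeMinOrder ℕ P] (hE : IsEulerian P) {x y : P} (h : x < y)
    (hr : grade ℕ x + 2 ≤ grade ℕ y) :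
    2 ≤ (Finset.univ.filter fun w => (x < w ∧ w < y) ∧ grade ℕ w = grade ℕ x + 1).card := by
  obtain ⟨w, hxw, hwy, hw⟩ := exists_grade_succ_le h
  have hwy' : w < y := lt_of_le_of_ne hwy (by rintro rfl; omega)
  by_contra hlt
  have huniq : ∀ v, x < v → v < y → grade ℕ v = grade ℕ x + 1 → v = w := by
    intro v h1 h2 h3
    refine Finset.card_le_one.1 (Nat.lt_succ_iff.1 (not_le.1 hlt)) v ?_ w ?_ <;> simp [*]
  have hs := hE.sum_neg_one_pow_grade h
  have hs' := hE.sum_neg_one_pow_grade hwy'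
  have : (Finset.univ.filter fun z => x ≤ z ∧ z ≤ y) =
      insert x (Finset.univ.filter fun z => w ≤ z ∧ z ≤ y) := by
    ext z
    simp only [Finset.mem_filter, Finset.mem_univ, true_and, Finset.mem_insert]
    constructor
    · rintro ⟨h1, h2⟩
      rcases h1.eq_or_lt with rfl | h1
      · exact Or.inl rfl
      · obtain ⟨v, hv1, hv2, hv3⟩ := exists_grade_succ_le h1
        have hvy : v < y := lt_of_le_of_ne (hv2.trans h2) (by rintro rfl; omega)
        exact Or.inr ⟨huniq v hv1 hvy hv3 ▸ hv2, h2⟩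
    · rintro (rfl | ⟨h1, h2⟩)
      · exact ⟨le_rfl, h.le⟩
      · exact ⟨hxw.le.trans h1, h2⟩
  rw [this, Finset.sum_insert, hs', add_zero] at hs
  · exact absurd hs (by simp)
  · simp [hxw.not_ge]

open Classical in
theorem IsEulerian.two_le_card_coatoms {P : Type*} [PartialOrder P] [Fintype P]
    [GradeMinOrder ℕ P] (hE : IsEulerian P) {x y : P} (h : x < y)
    (hr : grade ℕ x + 2 ≤ grade ℕ y) :
    2 ≤ (Finset.univ.filter fun w => (x < w ∧ w < y) ∧ grade ℕ w + 1 = grade ℕ y).card := by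
  obtain ⟨w, hxw, hwy, hw⟩ := exists_le_grade_succ h
  have hxw' : x < w := lt_of_le_of_ne hxw (by rintro rfl; omega)
  by_contra hlt
  have huniq : ∀ v, x < v → v < y → grade ℕ y = grade ℕ v + 1 → v = w := by
    intro v h1 h2 h3
    refine Finset.card_le_one.1 (Nat.lt_succ_iff.1 (not_le.1 hlt)) v ?_ w ?_ <;>
      (simp [*]; try omega)
  have hs := hE.sum_neg_one_pow_grade h
  have hs' := hE.sum_neg_one_pow_grade hxw'
  have : (Finset.univ.filter fun z => x ≤ z ∧ z ≤ y) =
      insert y (Finset.univ.filter fun z => x ≤ z ∧ z ≤ w) := by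
    ext z
    simp only [Finset.mem_filter, Finset.mem_univ, true_and, Finset.mem_insert]
    constructor
    · rintro ⟨h1, h2⟩
      rcases h2.eq_or_lt with rfl | h2
      · exact Or.inl rfl
      · obtain ⟨v, hv1, hv2, hv3⟩ := exists_le_grade_succ h2
        have hvx : x < v := lt_of_le_of_ne (h1.trans hv1) (by rintro rfl; omega)
        exact Or.inr ⟨h1, huniq v hvx hv2 hv3 ▸ hv1⟩
    · rintro (rfl | ⟨h1, h2⟩)
      · exact ⟨h.le, le_rfl⟩
      · exact ⟨h1, h2.trans hwy.le⟩
  rw [this, Finset.sum_insert, hs', add_zero] at hs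
  · exact absurd hs (by simp)
  · simp [hwy.not_ge]

open Classical in
theorem IsEulerian.card_between_eq_two {P : Type*} [PartialOrder P] [Fintype P]
    [GradeMinOrder ℕ P] (hE : IsEulerian P) {x y : P} (h : x < y)
    (hr : grade ℕ y = grade ℕ x + 2) :
    (Finset.univ.filter fun w => (x < w ∧ w < y) ∧ grade ℕ w = grade ℕ x + 1).card = 2 := by
  have hs := hE.sum_neg_one_pow_grade h
  have : (Finset.univ.filter fun z => x ≤ z ∧ z ≤ y) = insert x (insert y
      (Finset.univ.filter fun w => (x < w ∧ w < y) ∧ grade ℕ w = grade ℕ x + 1)) := by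
    ext z
    simp only [Finset.mem_filter, Finset.mem_univ, true_and, Finset.mem_insert]
    constructor
    · rintro ⟨h1, h2⟩
      rcases h1.eq_or_lt with rfl | h1
      · exact Or.inl rfl
      rcases h2.eq_or_lt with rfl | h2
      · exact Or.inr (Or.inl rfl)
      have h3 : grade ℕ x < grade ℕ z := grade_strictMono h1
      have h4 : grade ℕ z < grade ℕ y := grade_strictMono h2
      exact Or.inr (Or.inr ⟨⟨h1, h2⟩, by omega⟩)
    · rintro (rfl | rfl | h1)
      · exact ⟨le_rfl, h.le⟩
      · exact ⟨h.le, le_rfl⟩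
      · exact ⟨h1.1.1.le, h1.1.2.le⟩
  rw [this, Finset.sum_insert, Finset.sum_insert, Finset.sum_congr rfl
    (g := fun _ => (-1 : ℝ) ^ (grade ℕ x + 1)), Finset.sum_const, nsmul_eq_mul, hr] at hs
  · have h1 : (-1 : ℝ) ^ grade ℕ x *
        (2 - ((Finset.univ.filter fun w => (x < w ∧ w < y) ∧
          grade ℕ w = grade ℕ x + 1).card : ℝ)) = 0 := by
      rw [← hs]; ring
    have h2 := (mul_eq_zero.1 h1).resolve_left (by simp)
    have h3 : ((Finset.univ.filter fun w => (x < w ∧ w < y) ∧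
          grade ℕ w = grade ℕ x + 1).card : ℝ) = 2 := by linarith
    exact_mod_cast h3
  · intro z hz
    rw [(Finset.mem_filter.1 hz).2.2]
  · simp
  · simp [h.ne]

/-! ### Vanishing of the `L`-numbers of sets with an odd maximal interval -/

open Classical in
/-- Let `X` be given in the ranks from `r` to `m`, with `2 X(y) = -∑_{z < y} X(z)` above rank `r`.  The
Euler relation turns the equation for `X` into the equation `D(y) = -∑_{z ≤ y, ρ z > r} D(z)` for
`D(y) = X(y) + (-1)^(ρ y - r) X(y)`, and `D` vanishes by induction on the rank. -/
theorem IsEulerian.eq_zero_of_two_mul_eq_neg_sum {P : Type*} [PartialOrder P] [Fintype P]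
    [GradeMinOrder ℕ P] (hE : IsEulerian P) {r m : ℕ} {X : P → ℝ}
    (hX : ∀ y, r < grade ℕ y → grade ℕ y ≤ m → 2 * X y = -∑ z with z < y ∧ r ≤ grade ℕ z, X z)
    {y : P} (hy : r < grade ℕ y) (hym : grade ℕ y ≤ m) (heven : Even (grade ℕ y - r)) : X y = 0 := by
  have split_le : ∀ (f : P → ℝ) (s : ℕ) (y : P), s ≤ grade ℕ y →
      ∑ z with z ≤ y ∧ s ≤ grade ℕ z, f z = f y + ∑ z with z < y ∧ s ≤ grade ℕ z, f z := by
    intro f s y hs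
    have : (Finset.univ.filter fun z => z ≤ y ∧ s ≤ grade ℕ z) =
        insert y (Finset.univ.filter fun z => z < y ∧ s ≤ grade ℕ z) := by
      ext z
      simp only [Finset.mem_filter, Finset.mem_univ, true_and, Finset.mem_insert]
      constructor
      · rintro ⟨h1, h2⟩
        rcases h1.eq_or_lt with rfl | h1
        · exact Or.inl rfl
        · exact Or.inr ⟨h1, h2⟩
      · rintro (rfl | ⟨h1, h2⟩)
        · exact ⟨le_rfl, hs⟩
        · exact ⟨h1.le, h2⟩
    rw [this, Finset.sum_insert (by simp)]
  have split_rank : ∀ (f : P → ℝ) (y : P),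
      ∑ z with z ≤ y ∧ r ≤ grade ℕ z, f z =
        ∑ z with z ≤ y ∧ grade ℕ z = r, f z + ∑ z with z ≤ y ∧ r + 1 ≤ grade ℕ z, f z := by
    intro f y
    rw [← Finset.sum_union]
    · refine Finset.sum_congr ?_ fun _ _ => rfl
      ext z
      simp only [Finset.mem_filter, Finset.mem_univ, true_and, Finset.mem_union]
      constructor
      · rintro ⟨h1, h2⟩
        rcases h2.eq_or_lt with h3 | h3
        · exact Or.inl ⟨h1, h3.symm⟩
        · exact Or.inr ⟨h1, h3⟩
      · rintro (⟨h1, h2⟩ | ⟨h1, h2⟩)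
        · exact ⟨h1, h2.ge⟩
        · exact ⟨h1, by omega⟩
    · rw [Finset.disjoint_left]
      intro z hz hz'
      simp only [Finset.mem_filter] at hz hz'
      omega
  have hS : ∀ y, r < grade ℕ y → grade ℕ y ≤ m → ∑ z with z ≤ y ∧ r ≤ grade ℕ z, X z = - X y := by
    intro y hy hym
    have := hX y hy hym
    rw [split_le X r y hy.le]
    linarith
  have hS0 : ∀ y, grade ℕ y = r → ∑ z with z ≤ y ∧ r ≤ grade ℕ z, X z = X y := by
    intro y hy
    rw [split_le X r y hy.ge, Finset.sum_eq_zero, add_zero]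
    intro z hz
    simp only [Finset.mem_filter] at hz
    have : grade ℕ z < grade ℕ y := grade_strictMono hz.2.1
    omega
  -- sum the Euler relations of the intervals `[w, y]` with weights `X w`
  have hM : ∀ y, r < grade ℕ y →
      ∑ z with z ≤ y ∧ r ≤ grade ℕ z, (-1 : ℝ) ^ grade ℕ z *
        ∑ w with w ≤ z ∧ r ≤ grade ℕ w, X w = (-1) ^ grade ℕ y * X y := by
    intro y hy
    have e1 : ∀ z : P, (-1 : ℝ) ^ grade ℕ z * ∑ w with w ≤ z ∧ r ≤ grade ℕ w, X w =
        ∑ w with w ≤ z ∧ r ≤ grade ℕ w, (-1 : ℝ) ^ grade ℕ z * X w := fun z => Finset.mul_sum ..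
    simp only [e1]
    rw [Finset.sum_comm' (t' := Finset.univ.filter fun w => w ≤ y ∧ r ≤ grade ℕ w)
      (s' := fun w => Finset.univ.filter fun z => w ≤ z ∧ z ≤ y)]
    · simp only [← Finset.sum_mul]
      rw [Finset.sum_eq_single_of_mem y (by simp [hy.le])]
      · congr 1
        have : (Finset.univ.filter fun z => y ≤ z ∧ z ≤ y) = {y} := by
          ext z; simp [le_antisymm_iff, and_comm]
        rw [this, Finset.sum_singleton]
      · intro w hw hne
        simp only [Finset.mem_filter] at hw
        rw [hE.sum_neg_one_pow_grade (lt_of_le_of_ne hw.2.1 hne), zero_mul]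
    · intro z w
      simp only [Finset.mem_filter, Finset.mem_univ, true_and]
      constructor
      · rintro ⟨⟨h1, h2⟩, h3, h4⟩
        exact ⟨⟨h3, h1⟩, h3.trans h1, h4⟩
      · rintro ⟨⟨h1, h2⟩, h3, h4⟩
        exact ⟨⟨h2, h4.trans (grade_mono h1)⟩, h1, h4⟩
  have hD : ∀ k : ℕ, ∀ y, grade ℕ y = k → r < grade ℕ y → grade ℕ y ≤ m →
      X y + (-1) ^ r * ((-1) ^ grade ℕ y * X y) = 0 := by
    intro k
    induction k using Nat.strong_induction_on with
    | _ k ih =>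
      intro y hk hy hym
      have h1 := hM y hy
      have h2 := hS y hy hym
      rw [split_rank] at h1 h2
      rw [Finset.sum_congr rfl (g := fun z => (-1) ^ r * X z), ← Finset.mul_sum] at h1
      swap
      · intro z hz
        have hz := (Finset.mem_filter.1 hz).2.2
        rw [hS0 z hz, hz]
      have h3 : ∑ z with z ≤ y ∧ r + 1 ≤ grade ℕ z, (-1 : ℝ) ^ grade ℕ z *
          ∑ w with w ≤ z ∧ r ≤ grade ℕ w, X w =
          -∑ z with z ≤ y ∧ r + 1 ≤ grade ℕ z, (-1 : ℝ) ^ grade ℕ z * X z := by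
        rw [← Finset.sum_neg_distrib]
        refine Finset.sum_congr rfl fun z hz => ?_
        have hz := (Finset.mem_filter.1 hz).2
        rw [hS z hz.2 ((grade_mono hz.1).trans hym)]
        ring
      have h4 : ∑ z with z < y ∧ r + 1 ≤ grade ℕ z,
          (X z + (-1) ^ r * ((-1) ^ grade ℕ z * X z)) = 0 := by
        refine Finset.sum_eq_zero fun z hz => ?_
        have hz := (Finset.mem_filter.1 hz).2
        exact ih _ (hk ▸ grade_strictMono hz.1) z rfl hz.2 ((grade_mono hz.1.le).trans hym)
      rw [h3, split_le _ (r + 1) y hy] at h1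
      rw [split_le _ (r + 1) y hy] at h2
      rw [Finset.sum_add_distrib, ← Finset.mul_sum] at h4
      have hsq : (-1 : ℝ) ^ r * (-1) ^ r = 1 := by rw [← mul_pow]; simp
      set A := ∑ z with z ≤ y ∧ grade ℕ z = r, X z
      set B := ∑ z with z < y ∧ r + 1 ≤ grade ℕ z, (-1 : ℝ) ^ grade ℕ z * X z
      set C := ∑ z with z < y ∧ r + 1 ≤ grade ℕ z, X z
      set s := (-1 : ℝ) ^ r
      set t := (-1 : ℝ) ^ grade ℕ y * X y
      have h5 : s * (s * A) = A := by rw [← mul_assoc, hsq, one_mul]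
      have h6 : 2 * (s * t) = A - s * B := by
        rw [← h5]
        linear_combination (-s) * h1
      linarith
  have h1 := hD _ y rfl hy hym
  have h2 : (-1 : ℝ) ^ r * (-1) ^ grade ℕ y = 1 := by
    rw [← pow_add]
    refine Even.neg_one_pow ?_
    have : r + grade ℕ y = (grade ℕ y - r) + 2 * r := by omega
    rw [this]
    exact heven.add (even_two_mul r)
  rw [← mul_assoc, h2] at h1
  linarith

open Classical in
/-- A rank `j` that every contributing chain must contain cuts the chains into two parts. -/
theorem transfer_eq_sum_of_letter_eq_zero {P : Type*} [PartialOrder P] [Fintype P]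
    [BoundedOrder P] [GradeMinOrder ℕ P] {α β : ℕ → ℝ} {j : ℕ} (hj : j = 0 ∨ α j = 0) {y : P}
    (hy : j < grade ℕ y) :
    transfer α β j y = ∑ x with x < y ∧ grade ℕ x = j,
      (if j = 0 then 1 else β j * transfer α β (j - 1) x) := by
  cases j with
  | zero =>
    have hbot : grade ℕ (⊥ : P) = 0 := by simp
    have : (Finset.univ.filter fun x => x < y ∧ grade ℕ x = 0) = {⊥} := by
      ext x
      simp only [Finset.mem_filter, Finset.mem_univ, true_and, Finset.mem_singleton]
      constructor
      · rintro ⟨-, h⟩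
        by_contra hne
        have : grade ℕ (⊥ : P) < grade ℕ x := grade_strictMono (bot_lt_iff_ne_bot.2 hne)
        omega
      · rintro rfl
        refine ⟨bot_lt_iff_ne_bot.2 ?_, hbot⟩
        rintro rfl
        omega
    rw [this]
    simp [transfer]
  | succ k =>
    have h0 : α (k + 1) = 0 := hj.resolve_left (by omega)
    simp only [transfer, h0, zero_mul, zero_add, Nat.add_eq_zero_iff, one_ne_zero, and_false,
      if_false, Nat.add_sub_cancel]
    rw [Finset.mul_sum]

open Classical in
theorem transfer_eq_add_sum {P : Type*} [PartialOrder P] [Fintype P] [GradeMinOrder ℕ P]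
    {α β : ℕ → ℝ} {j : ℕ} : ∀ {k : ℕ}, j ≤ k →
    (∀ i, j < i → i ≤ k → α i = 1) → ∀ y : P,
    transfer α β k y = transfer α β j y +
      ∑ z with z < y ∧ (j < grade ℕ z ∧ grade ℕ z ≤ k),
        β (grade ℕ z) * transfer α β (grade ℕ z - 1) z := by
  intro k hjk
  induction k, hjk using Nat.le_induction with
  | base =>
    intro _ y
    rw [Finset.sum_eq_zero, add_zero]
    intro z hz
    simp only [Finset.mem_filter] at hz
    omega
  | succ k hjk ih =>
    intro hα y
    simp only [transfer]
    rw [hα (k + 1) (by omega) le_rfl, one_mul,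
      ih (fun i h1 h2 => hα i h1 (by omega)), add_assoc]
    congr 1
    have : (Finset.univ.filter fun z => z < y ∧ (j < grade ℕ z ∧ grade ℕ z ≤ k + 1)) =
        (Finset.univ.filter fun z => z < y ∧ (j < grade ℕ z ∧ grade ℕ z ≤ k)) ∪
        (Finset.univ.filter fun z => z < y ∧ grade ℕ z = k + 1) := by
      ext z
      simp only [Finset.mem_filter, Finset.mem_univ, true_and, Finset.mem_union]
      constructor
      · rintro ⟨h1, h2, h3⟩
        rcases h3.eq_or_lt with h4 | h4
        · exact Or.inr ⟨h1, h4⟩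
        · exact Or.inl ⟨h1, h2, by omega⟩
      · rintro (⟨h1, h2, h3⟩ | ⟨h1, h2⟩)
        · exact ⟨h1, h2, by omega⟩
        · exact ⟨h1, by omega, h2.le⟩
    rw [this, Finset.sum_union, Finset.mul_sum]
    · congr 1
      refine Finset.sum_congr rfl fun z hz => ?_
      simp only [Finset.mem_filter] at hz
      rw [hz.2.2, Nat.add_sub_cancel]
    · rw [Finset.disjoint_left]
      intro z hz hz'
      simp only [Finset.mem_filter] at hz hz'
      omega

/-- An odd block of letters `1 - [i ∈ T] / 2` kills the transfer function. -/
theorem IsEulerian.transfer_eq_zero {P : Type*} [PartialOrder P] [Fintype P] [BoundedOrder P]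
    [GradeMinOrder ℕ P] (hE : IsEulerian P) {α β : ℕ → ℝ} {j k : ℕ}
    (hj : j = 0 ∨ α j = 0) (hjk : j ≤ k) (hodd : Odd (k - j))
    (hα : ∀ i, j < i → i ≤ k → α i = 1) (hβ : ∀ i, j < i → i ≤ k → β i = -1 / 2)
    {y : P} (hy : grade ℕ y = k + 1) : transfer α β k y = 0 := by
  classical
  set c : P → ℝ := fun x => if j = 0 then 1 else β j * transfer α β (j - 1) x with hc
  set X : P → ℝ := fun z => if grade ℕ z = j then -2 * c z else transfer α β (grade ℕ z - 1) z
    with hXdef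
  have hX0 : ∀ z, grade ℕ z = j → X z = -2 * c z := fun z hz => by simp only [hXdef, if_pos hz]
  have hX1 : ∀ z, j < grade ℕ z → X z = transfer α β (grade ℕ z - 1) z :=
    fun z hz => by simp only [hXdef, if_neg hz.ne']
  have hrec : ∀ y, j < grade ℕ y → grade ℕ y ≤ k + 1 →
      2 * X y = -∑ z with z < y ∧ j ≤ grade ℕ z, X z := by
    intro y hjy hyk
    rw [hX1 y hjy, transfer_eq_add_sum (j := j) (by omega)
      (fun i h1 h2 => hα i h1 (by omega)), transfer_eq_sum_of_letter_eq_zero hj hjy]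
    have hsplit : (Finset.univ.filter fun z => z < y ∧ j ≤ grade ℕ z) =
        (Finset.univ.filter fun z => z < y ∧ grade ℕ z = j) ∪
        (Finset.univ.filter fun z => z < y ∧ (j < grade ℕ z ∧ grade ℕ z ≤ grade ℕ y - 1)) := by
      ext z
      simp only [Finset.mem_filter, Finset.mem_univ, true_and, Finset.mem_union]
      constructor
      · rintro ⟨h1, h2⟩
        have : grade ℕ z < grade ℕ y := grade_strictMono h1
        rcases h2.eq_or_lt with h4 | h4
        · exact Or.inl ⟨h1, h4.symm⟩
        · exact Or.inr ⟨h1, h4, by omega⟩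
      · rintro (⟨h1, h2⟩ | ⟨h1, h2, h3⟩)
        · exact ⟨h1, h2.ge⟩
        · exact ⟨h1, h2.le⟩
    have e1 : ∑ z with z < y ∧ grade ℕ z = j, X z =
        -2 * ∑ z with z < y ∧ grade ℕ z = j, c z := by
      rw [Finset.mul_sum]
      exact Finset.sum_congr rfl fun z hz => hX0 z (Finset.mem_filter.1 hz).2.2
    have e2 : ∑ z with z < y ∧ (j < grade ℕ z ∧ grade ℕ z ≤ grade ℕ y - 1),
          β (grade ℕ z) * transfer α β (grade ℕ z - 1) z =
        -1 / 2 * ∑ z with z < y ∧ (j < grade ℕ z ∧ grade ℕ z ≤ grade ℕ y - 1), X z := by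
      rw [Finset.mul_sum]
      refine Finset.sum_congr rfl fun z hz => ?_
      simp only [Finset.mem_filter] at hz
      rw [hβ _ hz.2.2.1 (by omega), hX1 z hz.2.2.1]
    rw [hsplit, Finset.sum_union, e1, e2]
    · ring
    · rw [Finset.disjoint_left]
      intro z hz hz'
      simp only [Finset.mem_filter] at hz hz'
      omega
  have hjy : j < grade ℕ y := by omega
  have h0 := hE.eq_zero_of_two_mul_eq_neg_sum hrec hjy hy.le (by
    obtain ⟨m, hm⟩ := hodd
    exact ⟨m + 1, by omega⟩)
  rwa [hX1 y hjy, hy, Nat.add_sub_cancel] at h0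

/-! ### Nonnegativity of the facet forms on Eulerian posets -/

open Classical in
theorem transfer_sub_half_sum {P : Type*} [PartialOrder P] [Fintype P] [BoundedOrder P]
    [GradeMinOrder ℕ P] {α β : ℕ → ℝ} {j i : ℕ} (hj : j = 0 ∨ α j = 0) (hji : j < i) {y : P}
    (hy : j < grade ℕ y) :
    transfer α β j y - 1 / 2 * ∑ v with v < y ∧ grade ℕ v = i, transfer α β j v =
      ∑ x with x < y ∧ grade ℕ x = j, (if j = 0 then 1 else β j * transfer α β (j - 1) x) *
        (1 - 1 / 2 *
          ((Finset.univ.filter fun v => (x < v ∧ v < y) ∧ grade ℕ v = i).card : ℝ)) := by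
  set c : P → ℝ := fun x => if j = 0 then 1 else β j * transfer α β (j - 1) x with hc
  have h1 : ∑ v with v < y ∧ grade ℕ v = i, transfer α β j v =
      ∑ v with v < y ∧ grade ℕ v = i, ∑ x with x < v ∧ grade ℕ x = j, c x := by
    refine Finset.sum_congr rfl fun v hv => ?_
    refine transfer_eq_sum_of_letter_eq_zero hj ?_
    rw [(Finset.mem_filter.1 hv).2.2]
    exact hji
  rw [h1, Finset.sum_comm' (t' := Finset.univ.filter fun x => x < y ∧ grade ℕ x = j)
      (s' := fun x => Finset.univ.filter fun v => (x < v ∧ v < y) ∧ grade ℕ v = i),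
    transfer_eq_sum_of_letter_eq_zero hj hy, Finset.mul_sum, ← Finset.sum_sub_distrib]
  · refine Finset.sum_congr rfl fun x _ => ?_
    rw [Finset.sum_const, nsmul_eq_mul]
    ring
  · intro v x
    simp only [Finset.mem_filter, Finset.mem_univ, true_and]
    constructor
    · rintro ⟨⟨h1, h2⟩, h3, h4⟩
      exact ⟨⟨⟨h3, h1⟩, h2⟩, h3.trans h1, h4⟩
    · rintro ⟨⟨⟨h1, h2⟩, h3⟩, h4, h5⟩
      exact ⟨⟨h2, h3⟩, h1, h5⟩

theorem transfer_eq_of_letters_trivial {P : Type*} [PartialOrder P] [Fintype P]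
    [GradeMinOrder ℕ P] {α β : ℕ → ℝ} {j k : ℕ} (hjk : j ≤ k)
    (hα : ∀ i, j < i → i ≤ k → α i = 1) (hβ : ∀ i, j < i → i ≤ k → β i = 0) (y : P) :
    transfer α β k y = transfer α β j y := by
  classical
  rw [transfer_eq_add_sum hjk hα, Finset.sum_eq_zero, add_zero]
  intro z hz
  simp only [Finset.mem_filter] at hz
  rw [hβ _ hz.2.2.1 hz.2.2.2, zero_mul]

open Classical in
/-- Two letters `1 - [i ∈ T] / 2` at the lower end of an interval of trivial letters amount to the
factor `1 - f_1 / 2`, where `f_1` is the number of atoms of the interval. -/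
theorem IsEulerian.transfer_eq_sum_atoms {P : Type*} [PartialOrder P] [Fintype P] [BoundedOrder P]
    [GradeMinOrder ℕ P] (hE : IsEulerian P) {α β : ℕ → ℝ} {j k : ℕ}
    (hj : j = 0 ∨ α j = 0) (hjk : j + 2 ≤ k) (hα : ∀ i, j < i → i ≤ k → α i = 1)
    (h1 : β (j + 1) = -1 / 2) (hβ : ∀ i, j + 2 < i → i ≤ k → β i = 0) {y : P}
    (hy : j < grade ℕ y) :
    transfer α β k y =
      ∑ x with x < y ∧ grade ℕ x = j, (if j = 0 then 1 else β j * transfer α β (j - 1) x) *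
        (1 - 1 / 2 *
          ((Finset.univ.filter fun v => (x < v ∧ v < y) ∧ grade ℕ v = j + 1).card : ℝ)) := by
  have e1 : ∀ z : P, j < grade ℕ z → transfer α β (j + 1) z =
      ∑ x with x < z ∧ grade ℕ x = j, (if j = 0 then 1 else β j * transfer α β (j - 1) x) *
        (1 - 1 / 2 *
          ((Finset.univ.filter fun v => (x < v ∧ v < z) ∧ grade ℕ v = j + 1).card : ℝ)) := by
    intro z hz
    rw [← transfer_sub_half_sum hj (by omega) hz]
    simp only [transfer]
    rw [hα (j + 1) (by omega) (by omega), h1]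
    ring
  rw [transfer_eq_of_letters_trivial (j := j + 2) hjk (fun i h1 h2 => hα i (by omega) h2) hβ,
    ← e1 y hy]
  simp only [transfer.eq_2 α β (j + 1)]
  rw [Finset.sum_eq_zero, hα (j + 1 + 1) (by omega) (by omega), one_mul, mul_zero, add_zero]
  intro z hz
  have hz := (Finset.mem_filter.1 hz).2
  rw [e1 z (by omega)]
  refine Finset.sum_eq_zero fun x hx => ?_
  have hx := (Finset.mem_filter.1 hx).2
  have := hE.card_between_eq_two hx.1 (by omega)
  rw [hx.2] at this
  rw [this]
  norm_num

open Classical in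
/-- Two letters `1 - [i ∈ T] / 2` at the upper end of an interval of trivial letters amount to the
factor `1 - f_m / 2`, where `f_m` is the number of coatoms of the interval. -/
theorem IsEulerian.transfer_eq_sum_coatoms {P : Type*} [PartialOrder P] [Fintype P]
    [BoundedOrder P] [GradeMinOrder ℕ P] (hE : IsEulerian P) {α β : ℕ → ℝ} {j m : ℕ}
    (hj : j = 0 ∨ α j = 0) (hjm : j ≤ m) (hα : ∀ i, j < i → i ≤ m + 2 → α i = 1)
    (hβ : ∀ i, j < i → i ≤ m → β i = 0) (h1 : β (m + 1) = -1 / 2) (h2 : β (m + 2) = -1 / 2)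
    {y : P} (hy : grade ℕ y = m + 3) :
    transfer α β (m + 2) y =
      ∑ x with x < y ∧ grade ℕ x = j, (if j = 0 then 1 else β j * transfer α β (j - 1) x) *
        (1 - 1 / 2 *
          ((Finset.univ.filter fun v => (x < v ∧ v < y) ∧ grade ℕ v = m + 2).card : ℝ)) := by
  have e0 : ∀ z : P, transfer α β m z = transfer α β j z := fun z =>
    transfer_eq_of_letters_trivial hjm (fun i h1 h2 => hα i h1 (by omega)) hβ z
  have e1 : ∀ z : P, transfer α β (m + 1) z = transfer α β j z -
      1 / 2 * ∑ w with w < z ∧ grade ℕ w = m + 1, transfer α β j w := by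
    intro z
    simp only [transfer, e0]
    rw [hα (m + 1) (by omega) (by omega), h1]
    ring
  rw [← transfer_sub_half_sum hj (by omega) (by omega)]
  simp only [transfer.eq_2 α β (m + 1), e1]
  rw [hα (m + 1 + 1) (by omega) le_rfl, h2, Finset.sum_sub_distrib, ← Finset.mul_sum]
  have e2 : ∑ v with v < y ∧ grade ℕ v = m + 1 + 1,
      ∑ w with w < v ∧ grade ℕ w = m + 1, transfer α β j w =
      2 * ∑ w with w < y ∧ grade ℕ w = m + 1, transfer α β j w := by
    rw [Finset.sum_comm' (t' := Finset.univ.filter fun x => x < y ∧ grade ℕ x = m + 1)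
      (s' := fun x => Finset.univ.filter fun v => (x < v ∧ v < y) ∧ grade ℕ v = m + 1 + 1),
      Finset.mul_sum]
    · refine Finset.sum_congr rfl fun w hw => ?_
      have hw := (Finset.mem_filter.1 hw).2
      have := hE.card_between_eq_two hw.1 (by omega)
      rw [hw.2] at this
      rw [Finset.sum_const, this, nsmul_eq_mul]
      norm_num
    · intro v x
      simp only [Finset.mem_filter, Finset.mem_univ, true_and]
      constructor
      · rintro ⟨⟨h1, h2⟩, h3, h4⟩
        exact ⟨⟨⟨h3, h1⟩, h2⟩, h3.trans h1, h4⟩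
      · rintro ⟨⟨⟨h1, h2⟩, h3⟩, h4, h5⟩
        exact ⟨⟨h2, h3⟩, h1, h5⟩
  rw [e2]
  ring

/-- The constant parts of the letters of the form of the pair `(M, V)`. -/
noncomputable def facetAlpha (V : Finset ℕ) (i : ℕ) : ℝ := if i ∈ V then 1 else 0

/-- The coefficients of `[i ∈ T]` in the letters of the form of the pair `(M, V)`. -/
noncomputable def facetBeta (M V : Finset ℕ) (i : ℕ) : ℝ :=
  if i ∈ M then -1 / 2 else if i ∈ V then 0 else 1 / 2

theorem isMaxInterval_of_boundary {S : Finset ℕ} {a b : ℕ} (hab : a ≤ b)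
    (hS : Finset.Icc a b ⊆ S) (ha : ∀ c, c + 1 = a → c ∉ S) (hb : b + 1 ∉ S) :
    IsMaxInterval S a b := by
  refine ⟨hab, hS, fun c d hc hd h => ?_⟩
  constructor
  · by_contra hne
    exact ha (a - 1) (by omega) (h (Finset.mem_Icc.2 ⟨by omega, by omega⟩))
  · by_contra hne
    exact hb (h (Finset.mem_Icc.2 ⟨by omega, by omega⟩))

open Classical in
/-- Induction over the ranks outside `V`: passing an interval of `V` that meets `M` changes the
sign, since intervals of length at least two in Eulerian posets have at least two atoms and at
least two coatoms. -/
theorem IsFacetPair.sign_transfer_nonneg {n : ℕ} {M V : Finset ℕ} (h : IsFacetPair n M V)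
    {P : Type*} [PartialOrder P] [Fintype P] [BoundedOrder P] [GradeMinOrder ℕ P]
    (hE : IsEulerian P) (j : ℕ) (hjV : j ∉ V) :
    ∃ e : ℕ, (M ∩ Finset.Icc 1 j).card = 2 * e ∧ ∀ x : P, grade ℕ x = j →
      0 ≤ (-1) ^ e * (if j = 0 then 1 else
        facetBeta M V j * transfer (facetAlpha V) (facetBeta M V) (j - 1) x) := by
  induction j using Nat.strong_induction_on with
  | _ j ih =>
    rcases Nat.eq_zero_or_pos j with rfl | hj0
    · exact ⟨0, by simp, by simp⟩
    have hV0 : 0 ∉ V := fun h0 => by simpa using h.subset_range h0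
    have hjM : j ∉ M := fun hj => hjV (h.subset hj)
    set i := Nat.findGreatest (· ∉ V) (j - 1) with hi
    have hiV : i ∉ V := Nat.findGreatest_spec (P := (· ∉ V)) (Nat.zero_le _) hV0
    have hij : i ≤ j - 1 := Nat.findGreatest_le _
    have hbetw : ∀ t, i < t → t ≤ j - 1 → t ∈ V := by
      intro t h1 h2
      by_contra h3
      exact absurd (Nat.le_findGreatest (P := (· ∉ V)) h2 h3) (by omega)
    obtain ⟨e, hcard, hpos⟩ := ih i (by omega) hiV
    have hMsplit : M ∩ Finset.Icc 1 j =
        (M ∩ Finset.Icc 1 i) ∪ (M ∩ Finset.Icc (i + 1) (j - 1)) := by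
      ext t
      simp only [Finset.mem_inter, Finset.mem_Icc, Finset.mem_union]
      constructor
      · rintro ⟨h1, h2, h3⟩
        have : t ≠ j := fun h => hjM (h ▸ h1)
        by_cases t ≤ i
        · exact Or.inl ⟨h1, h2, by omega⟩
        · exact Or.inr ⟨h1, by omega, by omega⟩
      · rintro (⟨h1, h2, h3⟩ | ⟨h1, h2, h3⟩)
        · exact ⟨h1, h2, by omega⟩
        · exact ⟨h1, by omega, by omega⟩
    have hcard' : (M ∩ Finset.Icc 1 j).card =
        2 * e + (M ∩ Finset.Icc (i + 1) (j - 1)).card := by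
      rw [hMsplit, Finset.card_union_of_disjoint, hcard]
      rw [Finset.disjoint_left]
      intro t ht ht'
      simp only [Finset.mem_inter, Finset.mem_Icc] at ht ht'
      omega
    have hcut : i = 0 ∨ facetAlpha V i = 0 := Or.inr (if_neg hiV)
    have hα : ∀ t, i < t → t ≤ j - 1 → facetAlpha V t = 1 := fun t h1 h2 => if_pos (hbetw t h1 h2)
    have hβM : ∀ t ∈ M, facetBeta M V t = -1 / 2 := fun t ht => if_pos ht
    have hβ0 : ∀ t, i < t → t ≤ j - 1 → t ∉ M → facetBeta M V t = 0 := by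
      intro t h1 h2 h3
      rw [facetBeta, if_neg h3, if_pos (hbetw t h1 h2)]
    have hβj : facetBeta M V j = 1 / 2 := by rw [facetBeta, if_neg hjM, if_neg hjV]
    have hstep : ∀ {e' : ℕ}, (M ∩ Finset.Icc 1 j).card = 2 * e' → (∀ x : P, grade ℕ x = j →
        0 ≤ (-1) ^ e' * transfer (facetAlpha V) (facetBeta M V) (j - 1) x) →
        ∃ e : ℕ, (M ∩ Finset.Icc 1 j).card = 2 * e ∧ ∀ x : P, grade ℕ x = j →
          0 ≤ (-1) ^ e * (if j = 0 then 1 else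
            facetBeta M V j * transfer (facetAlpha V) (facetBeta M V) (j - 1) x) := by
      intro e' h1 h2
      refine ⟨e', h1, fun x hx => ?_⟩
      rw [if_neg hj0.ne', hβj]
      have := h2 x hx
      linarith
    -- the two cases in which the interval meets `M`
    have hneg : ∀ t : ℕ, (∀ x y : P, x < y → grade ℕ x = i → grade ℕ y = j →
        2 ≤ (Finset.univ.filter fun v => (x < v ∧ v < y) ∧ grade ℕ v = t).card) →
        (∀ y : P, grade ℕ y = j → transfer (facetAlpha V) (facetBeta M V) (j - 1) y =
          ∑ x with x < y ∧ grade ℕ x = i, (if i = 0 then 1 else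
            facetBeta M V i * transfer (facetAlpha V) (facetBeta M V) (i - 1) x) *
            (1 - 1 / 2 *
              ((Finset.univ.filter fun v => (x < v ∧ v < y) ∧ grade ℕ v = t).card : ℝ))) →
        ∀ y : P, grade ℕ y = j →
          0 ≤ (-1) ^ (e + 1) * transfer (facetAlpha V) (facetBeta M V) (j - 1) y := by
      intro t h2 hsum y hy
      rw [hsum y hy, Finset.mul_sum]
      refine Finset.sum_nonneg fun x hx => ?_
      have hx := (Finset.mem_filter.1 hx).2
      have h3 := hpos x hx.2
      have h4 : (2 : ℝ) ≤
          ((Finset.univ.filter fun v => (x < v ∧ v < y) ∧ grade ℕ v = t).card : ℝ) := by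
        exact_mod_cast h2 x y hx.1 hx.2 hy
      rw [pow_succ]
      have := mul_nonneg h3 (by linarith : (0 : ℝ) ≤ 1 / 2 *
          ((Finset.univ.filter fun v => (x < v ∧ v < y) ∧ grade ℕ v = t).card : ℝ) - 1)
      linarith
    have hnone : (M ∩ Finset.Icc (i + 1) (j - 1)) = ∅ →
        ∃ e : ℕ, (M ∩ Finset.Icc 1 j).card = 2 * e ∧ ∀ x : P, grade ℕ x = j →
          0 ≤ (-1) ^ e * (if j = 0 then 1 else
            facetBeta M V j * transfer (facetAlpha V) (facetBeta M V) (j - 1) x) := by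
      intro hM
      refine hstep (e' := e) (by rw [hcard', hM]; simp) fun y hy => ?_
      rw [transfer_eq_of_letters_trivial hij hα, transfer_eq_sum_of_letter_eq_zero hcut (by omega),
        Finset.mul_sum]
      · exact Finset.sum_nonneg fun x hx => hpos x (Finset.mem_filter.1 hx).2.2
      · intro t h1 h2
        refine hβ0 t h1 h2 fun ht => ?_
        have : t ∈ M ∩ Finset.Icc (i + 1) (j - 1) :=
          Finset.mem_inter.2 ⟨ht, Finset.mem_Icc.2 ⟨by omega, h2⟩⟩
        simp [hM] at this
    rcases hij.eq_or_lt with heq | hlt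
    · exact hnone (by rw [Finset.Icc_eq_empty (by omega), Finset.inter_empty])
    have hmax : IsMaxInterval V (i + 1) (j - 1) := by
      refine isMaxInterval_of_boundary (by omega) ?_ ?_ ?_
      · intro t ht
        rw [Finset.mem_Icc] at ht
        exact hbetw t (by omega) ht.2
      · intro c hc
        obtain rfl : c = i := by omega
        exact hiV
      · rwa [Nat.sub_add_cancel hj0]
    rcases h.inter _ _ hmax with hM | hM | hM
    · exact hnone hM
    · have hm1 : i + 1 ∈ M ∩ Finset.Icc (i + 1) (j - 1) := hM ▸ (by simp)
      have hm2 : i + 2 ∈ M ∩ Finset.Icc (i + 1) (j - 1) := hM ▸ (by simp)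
      rw [Finset.mem_inter, Finset.mem_Icc] at hm1 hm2
      refine hstep (e' := e + 1) (by rw [hcard', hM]; simp; ring) (hneg (i + 1) ?_ ?_)
      · intro x y hxy hx hy
        have := hE.two_le_card_atoms hxy (by omega)
        rwa [hx] at this
      · intro y hy
        refine hE.transfer_eq_sum_atoms hcut (by omega) hα (hβM _ hm1.1) ?_ (by omega)
        intro t h1 h2
        refine hβ0 t (by omega) h2 fun ht => ?_
        have : t ∈ Finset.Icc (i + 1) (i + 1 + 1) :=
          hM ▸ Finset.mem_inter.2 ⟨ht, Finset.mem_Icc.2 ⟨by omega, h2⟩⟩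
        rw [Finset.mem_Icc] at this
        omega
    · have hcard2 : 2 ≤ (Finset.Icc (i + 1) (j - 1)).card := h.two_le_card _ _ hmax
      rw [Nat.card_Icc] at hcard2
      obtain ⟨m, rfl⟩ : ∃ m, j = m + 3 := ⟨j - 3, by omega⟩
      have hm1 : m + 1 ∈ M ∩ Finset.Icc (i + 1) (m + 3 - 1) := by
        rw [hM, Finset.mem_Icc]; omega
      have hm2 : m + 2 ∈ M ∩ Finset.Icc (i + 1) (m + 3 - 1) := by
        rw [hM, Finset.mem_Icc]; omega
      rw [Finset.mem_inter, Finset.mem_Icc] at hm1 hm2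
      have hc2 : (Finset.Icc (m + 3 - 1 - 1) (m + 3 - 1)).card = 2 := by
        rw [Nat.card_Icc]; omega
      refine hstep (e' := e + 1) (by rw [hcard', hM, hc2]; ring) (hneg (m + 2) ?_ ?_)
      · intro x y hxy hx hy
        have := hE.two_le_card_coatoms hxy (by omega)
        rw [hy] at this
        convert this using 4
        omega
      · intro y hy
        refine hE.transfer_eq_sum_coatoms hcut (by omega) hα ?_ (hβM _ hm1.1) (hβM _ hm2.1) hy
        intro t h1 h2
        refine hβ0 t (by omega) (by omega) fun ht => ?_
        have : t ∈ Finset.Icc (m + 3 - 1 - 1) (m + 3 - 1) :=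
          hM ▸ Finset.mem_inter.2 ⟨ht, Finset.mem_Icc.2 ⟨by omega, by omega⟩⟩
        rw [Finset.mem_Icc] at this
        omega

theorem IsFacetPair.wordForm_nonneg {n : ℕ} {M V : Finset ℕ} (h : IsFacetPair n M V)
    {P : Type*} [PartialOrder P] [Fintype P] [BoundedOrder P] [GradeMinOrder ℕ P]
    (hP : grade ℕ (⊤ : P) = n + 1) (hE : IsEulerian P) :
    0 ≤ (-1) ^ (M.card / 2) *
      wordForm n (facetAlpha V) (facetBeta M V) (flagVector n P) := by
  have hn : n + 1 ∉ V := fun h0 => by simpa using h.subset_range h0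
  obtain ⟨e, he, hpos⟩ := h.sign_transfer_nonneg hE (n + 1) hn
  have hM : M ∩ Finset.Icc 1 (n + 1) = M := by
    refine Finset.inter_eq_left.2 fun t ht => ?_
    have := Finset.mem_Icc.1 (h.subset_range (h.subset ht))
    exact Finset.mem_Icc.2 ⟨this.1, by omega⟩
  rw [hM] at he
  have := hpos ⊤ hP
  have hβ : facetBeta M V (n + 1) = 1 / 2 := by
    rw [facetBeta, if_neg fun h0 => hn (h.subset h0), if_neg hn]
  rw [if_neg (by omega), hβ, Nat.add_sub_cancel] at this
  rw [wordForm_flagVector hP, he, Nat.mul_div_cancel_left _ two_pos]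
  linarith

/-! ### The basis dual to the `L`-numbers -/

/-- The vector of `FlagSpace n` with `L_W = 1` and all other `L`-numbers zero. -/
noncomputable def dualVector (n : ℕ) (W : Finset ℕ) : FlagSpace n :=
  fun T => if Disjoint T.1 W then 2 ^ T.1.card else 0

/-- The word form as a linear map. -/
noncomputable def wordFormLM (n : ℕ) (α β : ℕ → ℝ) : FlagSpace n →ₗ[ℝ] ℝ where
  toFun := wordForm n α β
  map_add' x y := by
    simp only [wordForm, Pi.add_apply, mul_add, Finset.sum_add_distrib]
  map_smul' c x := by
    simp only [wordForm, Pi.smul_apply, smul_eq_mul, RingHom.id_apply, Finset.mul_sum]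
    exact Finset.sum_congr rfl fun _ _ => by ring

theorem wordForm_dualVector (n : ℕ) (α β : ℕ → ℝ) (W : Finset ℕ) :
    wordForm n α β (dualVector n W) =
      ∏ i ∈ Finset.Icc 1 n, ((if i ∈ W then 0 else 2 * β i) + α i) := by
  classical
  rw [Finset.prod_add, ← Finset.sum_coe_sort (Finset.Icc 1 n).powerset]
  refine Finset.sum_congr rfl fun T _ => ?_
  rw [dualVector]
  split_ifs with h
  · have h1 : ∏ i ∈ T.1, (if i ∈ W then 0 else 2 * β i) = 2 ^ T.1.card * ∏ i ∈ T.1, β i := by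
      rw [← Finset.prod_const, ← Finset.prod_mul_distrib]
      exact Finset.prod_congr rfl fun i hi => if_neg (Finset.disjoint_left.1 h hi)
    rw [h1]
    ring
  · obtain ⟨i, hi, hiW⟩ := Finset.not_disjoint_iff.1 h
    have h1 : ∏ i ∈ T.1, (if i ∈ W then 0 else 2 * β i) = 0 :=
      Finset.prod_eq_zero hi (if_pos hiW)
    rw [h1]
    simp

theorem wordForm_facet_dualVector {n : ℕ} {M V W : Finset ℕ} (hMV : M ⊆ V)
    (hV : V ⊆ Finset.Icc 1 n) (hW : W ⊆ Finset.Icc 1 n) :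
    wordForm n (facetAlpha V) (facetBeta M V) (dualVector n W) =
      if M ⊆ W ∧ W ⊆ V then 1 else 0 := by
  rw [wordForm_dualVector]
  split_ifs with h
  · refine Finset.prod_eq_one fun i _ => ?_
    have h1 := @h.1 i
    have h2 := @h.2 i
    have h3 := @hMV i
    clear h hMV hV hW
    by_cases hiV : i ∈ V <;> by_cases hiM : i ∈ M <;> by_cases hiW : i ∈ W <;>
      simp_all [facetAlpha, facetBeta]
  · rw [not_and_or, Finset.not_subset, Finset.not_subset] at h
    rcases h with ⟨i, hi, hiW⟩ | ⟨i, hi, hiV⟩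
    · refine Finset.prod_eq_zero (hV (hMV hi)) ?_
      simp [facetAlpha, facetBeta, hi, hiW, hMV hi]
      norm_num
    · refine Finset.prod_eq_zero (hW hi) ?_
      simp [facetAlpha, hi, hiV]

theorem flagL_eq_wordForm {n : ℕ} {Q : Finset ℕ} (hQ : Q ⊆ Finset.Icc 1 n) (x : FlagSpace n) :
    flagL n Q x = wordForm n (facetAlpha Q) (facetBeta Q Q) x := by
  classical
  rw [flagL, wordForm, Finset.mul_sum]
  refine Finset.sum_congr rfl fun T _ => ?_
  have hT := Finset.mem_powerset.1 T.2
  split_ifs with h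
  · have h1 : ∏ i ∈ Finset.Icc 1 n \ T.1, facetAlpha Q i = 1 := by
      refine Finset.prod_eq_one fun i hi => if_pos ?_
      by_contra hiQ
      rw [Finset.mem_sdiff] at hi
      exact hi.2 (h (Finset.mem_sdiff.2 ⟨hi.1, hiQ⟩))
    have h2 : ∏ i ∈ T.1, facetBeta Q Q i = ∏ i ∈ T.1, (if i ∈ Finset.Icc 1 n \ Q then -1 else 1) *
        (-1 / 2 : ℝ) := by
      refine Finset.prod_congr rfl fun i hi => ?_
      by_cases hiQ : i ∈ Q
      · simp [facetBeta, hiQ]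
      · have := hT hi
        rw [facetBeta, if_neg hiQ, if_neg hiQ, if_pos (Finset.mem_sdiff.2 ⟨this, hiQ⟩)]
        norm_num
    have h3 : ∏ i ∈ T.1, (if i ∈ Finset.Icc 1 n \ Q then (-1 : ℝ) else 1) = (-1) ^ (n - Q.card) := by
      rw [Finset.prod_ite, Finset.prod_const, Finset.prod_const_one, mul_one]
      have : T.1.filter (· ∈ Finset.Icc 1 n \ Q) = Finset.Icc 1 n \ Q := by
        ext i
        rw [Finset.mem_filter]
        exact ⟨fun hi => hi.2, fun hi => ⟨h hi, hi⟩⟩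
      rw [this, Finset.card_sdiff_of_subset hQ, Nat.card_Icc, Nat.add_sub_cancel]
    rw [h1, h2, Finset.prod_mul_distrib, h3, Finset.prod_const]
    ring
  · obtain ⟨i, hi, hiT⟩ := Finset.not_subset.1 h
    rw [Finset.mem_sdiff] at hi
    rw [Finset.prod_eq_zero (Finset.mem_sdiff.2 ⟨hi.1, hiT⟩) (if_neg hi.2)]
    simp

theorem flagL_dualVector {n : ℕ} {Q W : Finset ℕ} (hQ : Q ⊆ Finset.Icc 1 n)
    (hW : W ⊆ Finset.Icc 1 n) : flagL n Q (dualVector n W) = if Q = W then 1 else 0 := by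
  rw [flagL_eq_wordForm hQ, wordForm_facet_dualVector subset_rfl hQ hW]
  simp only [← Finset.Subset.antisymm_iff]

theorem linearIndependent_dualVector (n : ℕ) :
    LinearIndependent ℝ fun W : ↥((Finset.Icc 1 n).powerset) => dualVector n W.1 := by
  rw [Fintype.linearIndependent_iff]
  intro g hg Q
  have h := congrArg (wordFormLM n (facetAlpha Q.1) (facetBeta Q.1 Q.1)) hg
  rw [map_sum, map_zero, Finset.sum_eq_single_of_mem Q (Finset.mem_univ _), map_smul] at h
  · change g Q • wordForm n _ _ _ = 0 at h
    have hQ := Finset.mem_powerset.1 Q.2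
    rw [wordForm_facet_dualVector subset_rfl hQ hQ] at h
    simpa using h
  · intro W _ hne
    rw [map_smul]
    change g W • wordForm n _ _ _ = 0
    rw [wordForm_facet_dualVector subset_rfl (Finset.mem_powerset.1 Q.2)
      (Finset.mem_powerset.1 W.2), if_neg, smul_zero]
    intro h
    exact hne (Subtype.ext (h.2.antisymm h.1))

/-- The basis dual to the `L`-numbers. -/
noncomputable def dualBasis (n : ℕ) :
    Module.Basis ↥((Finset.Icc 1 n).powerset) ℝ (FlagSpace n) :=
  haveI : Nonempty ↥((Finset.Icc 1 n).powerset) := ⟨⟨∅, Finset.empty_mem_powerset _⟩⟩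
  basisOfLinearIndependentOfCardEqFinrank (linearIndependent_dualVector n) (by simp)

theorem dualBasis_apply (n : ℕ) (W : ↥((Finset.Icc 1 n).powerset)) :
    dualBasis n W = dualVector n W.1 := by
  simp [dualBasis]

theorem sum_flagL_smul_dualVector (n : ℕ) (x : FlagSpace n) :
    ∑ W : ↥((Finset.Icc 1 n).powerset), flagL n W.1 x • dualVector n W.1 = x := by
  have h : ∑ W : ↥((Finset.Icc 1 n).powerset),
      (wordFormLM n (facetAlpha W.1) (facetBeta W.1 W.1)).smulRight (dualVector n W.1) =
      LinearMap.id := by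
    refine (dualBasis n).ext fun Q => ?_
    rw [dualBasis_apply, LinearMap.sum_apply, Finset.sum_eq_single_of_mem Q (Finset.mem_univ _)]
    · rw [LinearMap.smulRight_apply]
      change wordForm n _ _ _ • dualVector n Q.1 = _
      have hQ := Finset.mem_powerset.1 Q.2
      rw [wordForm_facet_dualVector subset_rfl hQ hQ]
      simp
    · intro W _ hne
      rw [LinearMap.smulRight_apply]
      change wordForm n _ _ _ • dualVector n W.1 = _
      rw [wordForm_facet_dualVector subset_rfl (Finset.mem_powerset.1 W.2)
        (Finset.mem_powerset.1 Q.2), if_neg, zero_smul]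
      intro h
      exact hne (Subtype.ext (h.1.antisymm h.2))
  have h' := LinearMap.congr_fun h x
  rw [LinearMap.sum_apply] at h'
  refine Eq.trans (Finset.sum_congr rfl fun W _ => ?_) h'
  rw [flagL_eq_wordForm (Finset.mem_powerset.1 W.2)]
  rfl

theorem facetForm_eq_wordForm {n : ℕ} {M V : Finset ℕ} (hMV : M ⊆ V) (hV : V ⊆ Finset.Icc 1 n)
    (x : FlagSpace n) :
    facetForm n M V x =
      (-1) ^ (M.card / 2) * wordForm n (facetAlpha V) (facetBeta M V) x := by
  have h : ∑ Q ∈ V.powerset with M ⊆ Q, wordFormLM n (facetAlpha Q) (facetBeta Q Q) =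
      wordFormLM n (facetAlpha V) (facetBeta M V) := by
    refine (dualBasis n).ext fun W => ?_
    have hW := Finset.mem_powerset.1 W.2
    rw [dualBasis_apply, LinearMap.sum_apply]
    change ∑ Q ∈ V.powerset with M ⊆ Q, wordForm n _ _ _ = wordForm n _ _ _
    rw [wordForm_facet_dualVector hMV hV hW, Finset.sum_congr rfl
      (g := fun Q => if Q = W.1 then 1 else 0), Finset.sum_ite_eq']
    · simp [and_comm]
    · intro Q hQ
      rw [Finset.mem_filter, Finset.mem_powerset] at hQ
      rw [wordForm_facet_dualVector subset_rfl (hQ.1.trans hV) hW]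
      simp only [← Finset.Subset.antisymm_iff]
  have h' := LinearMap.congr_fun h x
  rw [LinearMap.sum_apply] at h'
  rw [facetForm]
  congr 1
  refine Eq.trans (Finset.sum_congr rfl fun Q hQ => ?_) h'
  rw [Finset.mem_filter, Finset.mem_powerset] at hQ
  exact flagL_eq_wordForm (hQ.1.trans hV) x

/-- The form of the pair `(M, V)` as a linear map. -/
noncomputable def facetFormLM (n : ℕ) (M V : Finset ℕ) : FlagSpace n →ₗ[ℝ] ℝ :=
  (-1 : ℝ) ^ (M.card / 2) • wordFormLM n (facetAlpha V) (facetBeta M V)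

theorem facetFormLM_apply {n : ℕ} {M V : Finset ℕ} (hMV : M ⊆ V) (hV : V ⊆ Finset.Icc 1 n)
    (x : FlagSpace n) : facetFormLM n M V x = facetForm n M V x :=
  (facetForm_eq_wordForm hMV hV x).symm

theorem facetForm_dualVector {n : ℕ} {M V W : Finset ℕ} (hMV : M ⊆ V)
    (hV : V ⊆ Finset.Icc 1 n) (hW : W ⊆ Finset.Icc 1 n) :
    facetForm n M V (dualVector n W) =
      (-1) ^ (M.card / 2) * if M ⊆ W ∧ W ⊆ V then 1 else 0 := by
  rw [facetForm_eq_wordForm hMV hV, wordForm_facet_dualVector hMV hV hW]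

/-! ### The linear span of the cone -/

/-- A set is even if all its maximal intervals have an even number of elements. -/
def IsEvenSet (W : Finset ℕ) : Prop :=
  ∀ a b, IsMaxInterval W a b → Even (Finset.Icc a b).card

theorem IsMaxInterval.succ_notMem {S : Finset ℕ} {a b : ℕ} (h : IsMaxInterval S a b) :
    b + 1 ∉ S := by
  intro hb
  have := (h.2.2 a (b + 1) le_rfl (by omega) fun t ht => by
    rw [Finset.mem_Icc] at ht
    rcases Nat.lt_or_ge b t with h1 | h1
    · obtain rfl : t = b + 1 := by omega
      exact hb
    · exact h.2.1 (Finset.mem_Icc.2 ⟨ht.1, h1⟩)).2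
  omega

theorem IsMaxInterval.pred_notMem {S : Finset ℕ} {a b c : ℕ} (h : IsMaxInterval S a b)
    (hc : c + 1 = a) : c ∉ S := by
  intro hb
  have := (h.2.2 c b (by omega) le_rfl fun t ht => by
    rw [Finset.mem_Icc] at ht
    rcases Nat.lt_or_ge t a with h1 | h1
    · obtain rfl : t = c := by omega
      exact hb
    · exact h.2.1 (Finset.mem_Icc.2 ⟨h1, ht.2⟩)).1
  omega

/-- The linear relations among the flag numbers of Eulerian posets: the `L`-numbers of sets that
are not even vanish. -/
theorem IsEulerian.flagL_eq_zero {n : ℕ} {P : Type*} [PartialOrder P] [Fintype P] [BoundedOrder P]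
    [GradeMinOrder ℕ P] (hP : grade ℕ (⊤ : P) = n + 1) (hE : IsEulerian P) {W : Finset ℕ}
    (hW : W ⊆ Finset.Icc 1 n) (hodd : ¬ IsEvenSet W) : flagL n W (flagVector n P) = 0 := by
  classical
  simp only [IsEvenSet, not_forall] at hodd
  obtain ⟨a, b, hmax, hab⟩ := hodd
  rw [Nat.not_even_iff_odd, Nat.card_Icc] at hab
  have hle := hmax.1
  have ha := Finset.mem_Icc.1 (hW (hmax.2.1 (Finset.mem_Icc.2 ⟨le_rfl, hle⟩)))
  have hb := Finset.mem_Icc.1 (hW (hmax.2.1 (Finset.mem_Icc.2 ⟨hle, le_rfl⟩)))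
  obtain ⟨j, rfl⟩ : ∃ j, a = j + 1 := ⟨a - 1, by omega⟩
  have hj : j ∉ W := hmax.pred_notMem rfl
  have hmem : ∀ i, j < i → i ≤ b → i ∈ W := fun i h1 h2 =>
    hmax.2.1 (Finset.mem_Icc.2 ⟨h1, h2⟩)
  have h0 : ∀ y : P, grade ℕ y = b + 1 →
      transfer (facetAlpha W) (facetBeta W W) b y = 0 := fun y hy =>
    hE.transfer_eq_zero (Or.inr (if_neg hj)) (by omega)
      (by rwa [Nat.add_sub_add_right] at hab) (fun i h1 h2 => if_pos (hmem i h1 h2))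
      (fun i h1 h2 => if_pos (hmem i h1 h2)) hy
  rw [flagL_eq_wordForm hW, wordForm_flagVector hP]
  rcases hb.2.eq_or_lt with rfl | hlt
  · exact h0 _ hP
  · have : ∀ k, b + 1 ≤ k → ∀ y : P, transfer (facetAlpha W) (facetBeta W W) k y = 0 := by
      intro k hk
      induction k, hk using Nat.le_induction with
      | base =>
        intro y
        simp only [transfer]
        rw [show facetAlpha W (b + 1) = 0 from if_neg hmax.succ_notMem,
          Finset.sum_eq_zero fun z hz => h0 z (Finset.mem_filter.1 hz).2.2]
        simp
      | succ k _ ih =>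
        intro y
        simp [transfer, ih]
    exact this n hlt _

/-- The space of vectors whose `L`-numbers are supported on even sets. -/
def evenSpace (n : ℕ) : Submodule ℝ (FlagSpace n) :=
  Submodule.span ℝ (dualVector n '' {W | W ⊆ Finset.Icc 1 n ∧ IsEvenSet W})

theorem mem_evenSpace_of_flagL_eq_zero {n : ℕ} {x : FlagSpace n}
    (h : ∀ W ⊆ Finset.Icc 1 n, ¬ IsEvenSet W → flagL n W x = 0) : x ∈ evenSpace n := by
  rw [← sum_flagL_smul_dualVector n x]
  refine Submodule.sum_mem _ fun W _ => ?_
  have hW := Finset.mem_powerset.1 W.2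
  by_cases hev : IsEvenSet W.1
  · exact Submodule.smul_mem _ _ (Submodule.subset_span ⟨W.1, ⟨hW, hev⟩, rfl⟩)
  · rw [h W.1 hW hev, zero_smul]
    exact Submodule.zero_mem _

theorem flagL_eq_zero_of_mem_evenSpace {n : ℕ} {x : FlagSpace n} (hx : x ∈ evenSpace n)
    {Q : Finset ℕ} (hQ : Q ⊆ Finset.Icc 1 n) (hodd : ¬ IsEvenSet Q) : flagL n Q x = 0 := by
  have : evenSpace n ≤ LinearMap.ker (wordFormLM n (facetAlpha Q) (facetBeta Q Q)) := by
    refine Submodule.span_le.2 ?_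
    rintro _ ⟨W, ⟨hW, hev⟩, rfl⟩
    change wordForm n _ _ _ = 0
    rw [← flagL_eq_wordForm hQ, flagL_dualVector hQ hW, if_neg]
    rintro rfl
    exact hodd hev
  rw [flagL_eq_wordForm hQ]
  exact this hx

theorem eulerianCone_subset_evenSpace (n : ℕ) : eulerianCone n ⊆ evenSpace n := by
  refine closure_minimal ?_ (evenSpace n).closed_of_finiteDimensional
  have : PointedCone.hull ℝ (eulerianFlagVectors n) ≤
      (evenSpace n).restrictScalars {c : ℝ // 0 ≤ c} := by
    refine Submodule.span_le.2 ?_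
    rintro _ ⟨P, _, _, _, _, hP, hE, rfl⟩
    exact mem_evenSpace_of_flagL_eq_zero fun W hW hodd => hE.flagL_eq_zero hP hW hodd
  exact this

/-- Vectors `x_S` in a subspace whose `L`-numbers form a triangular matrix span all vectors with
`L`-numbers supported on even sets. -/
theorem evenSpace_le_of_triangular {n : ℕ} (A : Submodule ℝ (FlagSpace n))
    (h : ∀ S ⊆ Finset.Icc 1 n, IsEvenSet S → ∃ x ∈ A, x ∈ evenSpace n ∧ flagL n S x ≠ 0 ∧
      ∀ Q ⊆ Finset.Icc 1 n, ¬ Q ⊆ S → flagL n Q x = 0) :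
    evenSpace n ≤ A := by
  have key : ∀ S : Finset ℕ, S ⊆ Finset.Icc 1 n → IsEvenSet S → dualVector n S ∈ A := by
    intro S
    induction S using Finset.strongInduction with
    | _ S ih =>
      intro hS hev
      obtain ⟨x, hxA, hxE, hne, htri⟩ := h S hS hev
      have hsum := sum_flagL_smul_dualVector n x
      have hSm : S ∈ (Finset.Icc 1 n).powerset := Finset.mem_powerset.2 hS
      rw [← Finset.add_sum_erase _ _ (Finset.mem_univ (⟨S, hSm⟩ : ↥(Finset.Icc 1 n).powerset))]
        at hsum
      have h1 : ∑ W ∈ Finset.univ.erase (⟨S, hSm⟩ : ↥(Finset.Icc 1 n).powerset),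
          flagL n W.1 x • dualVector n W.1 ∈ A := by
        refine Submodule.sum_mem _ fun W hW => ?_
        have hWn := Finset.mem_powerset.1 W.2
        have hWS : W.1 ≠ S := fun h => (Finset.mem_erase.1 hW).1 (Subtype.ext h)
        by_cases hsub : W.1 ⊆ S
        · by_cases hWev : IsEvenSet W.1
          · exact A.smul_mem _ (ih W.1 (hsub.ssubset_of_ne hWS) hWn hWev)
          · rw [flagL_eq_zero_of_mem_evenSpace hxE hWn hWev, zero_smul]
            exact A.zero_mem
        · rw [htri W.1 hWn hsub, zero_smul]
          exact A.zero_mem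
      have h2 : flagL n S x • dualVector n S ∈ A := by
        rw [← eq_sub_iff_add_eq] at hsum
        change flagL n S x • dualVector n S = _ at hsum
        rw [hsum]
        exact A.sub_mem hxA h1
      rwa [A.smul_mem_iff hne] at h2
  refine Submodule.span_le.2 ?_
  rintro _ ⟨S, ⟨hS, hev⟩, rfl⟩
  exact key S hS hev

/-! ### Eulerian posets from systems of disjoint even intervals -/

/-- A system of pairwise disjoint intervals of even cardinality contained in `[1, n]`. -/
structure BlockSystem (n : ℕ) where
  /-- The intervals of the system. -/
  blocks : Finset (Finset ℕ)
  eq_of_mem : ∀ B ∈ blocks, ∀ B' ∈ blocks, ∀ i, i ∈ B → i ∈ B' → B = B'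
  interval : ∀ B ∈ blocks, ∃ a b, a ≤ b ∧ B = Finset.Icc a b ∧ Even (Finset.Icc a b).card
  subset_range : ∀ B ∈ blocks, B ⊆ Finset.Icc 1 n

/-- The ladder with two elements in each of the ranks `1, …, n`, where each interval of ranks in
the block system is replaced by `K + 1` disjoint copies of itself.  An element is given by its
rank, its position `sign` within the ladder and the number `copy` of its copy; outside the blocks
there is only the copy `0`, and in the ranks `0` and `n + 1` only the sign `false`. -/
@[ext]
structure BlockPoset {n : ℕ} (𝓑 : BlockSystem n) (K : ℕ) where
  /-- The rank of an element. -/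
  rank : ℕ
  /-- The position of an element within its rank of the ladder. -/
  sign : Bool
  /-- The number of the copy in which an element lies. -/
  copy : ℕ
  rank_le : rank ≤ n + 1
  copy_le : copy ≤ K
  copy_eq_zero : (∀ B ∈ 𝓑.blocks, rank ∉ B) → copy = 0
  sign_eq_false : rank = 0 ∨ rank = n + 1 → sign = false

namespace BlockPoset

variable {n : ℕ} {𝓑 : BlockSystem n} {K : ℕ}

noncomputable instance : Fintype (BlockPoset 𝓑 K) :=
  haveI : Finite (BlockPoset 𝓑 K) := by
    refine Finite.of_injective (β := Fin (n + 2) × Bool × Fin (K + 1))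
      (fun x => (⟨x.rank, Nat.lt_succ_of_le x.rank_le⟩, x.sign,
        ⟨x.copy, Nat.lt_succ_of_le x.copy_le⟩)) fun x y h => ?_
    simp only [Prod.mk.injEq, Fin.mk.injEq] at h
    exact BlockPoset.ext h.1 h.2.1 h.2.2
  Fintype.ofFinite _

/-- The strict order: ranks increase, and within a block the copy does not change. -/
def Rel (x y : BlockPoset 𝓑 K) : Prop :=
  x.rank < y.rank ∧ ∀ B ∈ 𝓑.blocks, x.rank ∈ B → y.rank ∈ B → x.copy = y.copy

theorem mem_of_between {B : Finset ℕ} (hB : B ∈ 𝓑.blocks) {i j k : ℕ} (hi : i ∈ B) (hk : k ∈ B)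
    (hij : i ≤ j) (hjk : j ≤ k) : j ∈ B := by
  obtain ⟨a, b, -, rfl, -⟩ := 𝓑.interval B hB
  rw [Finset.mem_Icc] at *
  omega

theorem Rel.trans {x y z : BlockPoset 𝓑 K} (h : Rel x y) (h' : Rel y z) : Rel x z := by
  refine ⟨h.1.trans h'.1, fun B hB hx hz => ?_⟩
  have hy := mem_of_between hB hx hz h.1.le h'.1.le
  exact (h.2 B hB hx hy).trans (h'.2 B hB hy hz)

instance : PartialOrder (BlockPoset 𝓑 K) where
  le x y := x = y ∨ Rel x y
  lt := Rel
  le_refl x := Or.inl rfl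
  le_trans := by
    rintro x y z (rfl | h) (rfl | h')
    · exact Or.inl rfl
    · exact Or.inr h'
    · exact Or.inr h
    · exact Or.inr (h.trans h')
  le_antisymm := by
    rintro x y (rfl | h) (h' | h')
    · rfl
    · rfl
    · exact h'.symm
    · exact absurd h.1 h'.1.not_gt
  lt_iff_le_not_ge := by
    intro x y
    constructor
    · intro h
      refine ⟨Or.inr h, ?_⟩
      rintro (rfl | h')
      · exact lt_irrefl _ h.1
      · exact h.1.not_gt h'.1
    · rintro ⟨rfl | h, h'⟩
      · exact absurd (Or.inl rfl) h'
      · exact h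

theorem lt_def {x y : BlockPoset 𝓑 K} : x < y ↔ x.rank < y.rank ∧
    ∀ B ∈ 𝓑.blocks, x.rank ∈ B → y.rank ∈ B → x.copy = y.copy := Iff.rfl

theorem zero_notMem {B : Finset ℕ} (hB : B ∈ 𝓑.blocks) : 0 ∉ B := fun h => by
  simpa using 𝓑.subset_range B hB h

theorem succ_notMem {B : Finset ℕ} (hB : B ∈ 𝓑.blocks) : n + 1 ∉ B := fun h => by
  simpa using 𝓑.subset_range B hB h

instance : BoundedOrder (BlockPoset 𝓑 K) where
  bot := ⟨0, false, 0, by omega, by omega, fun _ => rfl, fun _ => rfl⟩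
  top := ⟨n + 1, false, 0, by omega, by omega, fun _ => rfl, fun _ => rfl⟩
  bot_le x := by
    rcases Nat.eq_zero_or_pos x.rank with h | h
    · refine Or.inl (BlockPoset.ext h.symm (x.sign_eq_false (Or.inl h)).symm
        (x.copy_eq_zero fun B hB => ?_).symm)
      rw [h]
      exact zero_notMem hB
    · exact Or.inr ⟨h, fun B hB h0 => absurd h0 (zero_notMem hB)⟩
  le_top x := by
    rcases x.rank_le.eq_or_lt with h | h
    · refine Or.inl (BlockPoset.ext h (x.sign_eq_false (Or.inr h)) (x.copy_eq_zero fun B hB => ?_))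
      rw [h]
      exact succ_notMem hB
    · exact Or.inr ⟨h, fun B hB _ h0 => absurd h0 (succ_notMem hB)⟩

theorem rank_top : (⊤ : BlockPoset 𝓑 K).rank = n + 1 := rfl

theorem rank_bot : (⊥ : BlockPoset 𝓑 K).rank = 0 := rfl

open Classical in
theorem card_rank_eq {m : ℕ} (hm : 1 ≤ m) (hmn : m ≤ n) (p : ℕ → Prop)
    [DecidablePred p] :
    (Finset.univ.filter fun z : BlockPoset 𝓑 K => z.rank = m ∧ p z.copy).card =
      2 * ((Finset.range (K + 1)).filter fun c =>
        ((∀ B ∈ 𝓑.blocks, m ∉ B) → c = 0) ∧ p c).card := by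
  rw [← Fintype.card_bool, ← Finset.card_univ (α := Bool), ← Finset.card_product]
  refine Finset.card_bij (fun z _ => (z.sign, z.copy)) ?_ ?_ ?_
  · intro z hz
    simp only [Finset.mem_filter, Finset.mem_univ, true_and] at hz
    simp only [Finset.mem_product, Finset.mem_univ, true_and, Finset.mem_filter, Finset.mem_range]
    exact ⟨Nat.lt_succ_of_le z.copy_le, hz.1 ▸ z.copy_eq_zero, hz.2⟩
  · intro z hz w hw h
    simp only [Finset.mem_filter, Finset.mem_univ, true_and] at hz hw
    simp only [Prod.mk.injEq] at h
    exact BlockPoset.ext (hz.1.trans hw.1.symm) h.1 h.2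
  · rintro ⟨s, c⟩ h
    simp only [Finset.mem_product, Finset.mem_univ, true_and, Finset.mem_filter,
      Finset.mem_range] at h
    exact ⟨⟨m, s, c, by omega, by omega, h.2.1, fun h => by omega⟩, by simp [h.2.2], rfl⟩

open Classical in
/-- The number of elements of given rank in an open interval. -/
theorem card_between {x y : BlockPoset 𝓑 K} (hxy : x < y) {m : ℕ} (hm : x.rank < m)
    (hmy : m < y.rank) :
    (Finset.univ.filter fun z => (x < z ∧ z < y) ∧ z.rank = m).card =
      2 * if ∃ B ∈ 𝓑.blocks, m ∈ B ∧ x.rank ∉ B ∧ y.rank ∉ B then K + 1 else 1 := by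
  have hyn := y.rank_le
  have h1 : (Finset.univ.filter fun z => (x < z ∧ z < y) ∧ z.rank = m) =
      Finset.univ.filter fun z : BlockPoset 𝓑 K => z.rank = m ∧
        ((∀ B ∈ 𝓑.blocks, x.rank ∈ B → m ∈ B → x.copy = z.copy) ∧
          ∀ B ∈ 𝓑.blocks, m ∈ B → y.rank ∈ B → z.copy = y.copy) := by
    refine Finset.filter_congr fun z _ => ?_
    rw [lt_def, lt_def]
    constructor
    · rintro ⟨⟨h1, h2⟩, rfl⟩
      exact ⟨rfl, h1.2, h2.2⟩
    · rintro ⟨rfl, h1, h2⟩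
      exact ⟨⟨⟨hm, h1⟩, hmy, h2⟩, rfl⟩
  rw [h1, card_rank_eq (by omega) (by omega) fun c =>
    (∀ B ∈ 𝓑.blocks, x.rank ∈ B → m ∈ B → x.copy = c) ∧
      ∀ B ∈ 𝓑.blocks, m ∈ B → y.rank ∈ B → c = y.copy]
  congr 1
  by_cases hB : ∃ B ∈ 𝓑.blocks, m ∈ B
  · obtain ⟨B, hB, hmB⟩ := hB
    have huniq : ∀ B' ∈ 𝓑.blocks, m ∈ B' → B' = B := fun B' hB' h =>
      𝓑.eq_of_mem _ hB' _ hB m h hmB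
    by_cases hx : x.rank ∈ B
    · rw [if_neg, Finset.card_eq_one]
      · refine ⟨x.copy, ?_⟩
        ext c
        simp only [Finset.mem_filter, Finset.mem_range, Finset.mem_singleton]
        constructor
        · exact fun h => (h.2.2.1 B hB hx hmB).symm
        · rintro rfl
          refine ⟨Nat.lt_succ_of_le x.copy_le, fun h => absurd hmB (h B hB), fun _ _ _ _ => rfl,
            fun B' hB' h1 h2 => ?_⟩
          rw [huniq B' hB' h1] at h2
          exact hxy.2 B hB hx h2
      · rintro ⟨B', hB', h1, h2, -⟩
        exact h2 (huniq B' hB' h1 ▸ hx)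
    · by_cases hy : y.rank ∈ B
      · rw [if_neg, Finset.card_eq_one]
        · refine ⟨y.copy, ?_⟩
          ext c
          simp only [Finset.mem_filter, Finset.mem_range, Finset.mem_singleton]
          constructor
          · exact fun h => h.2.2.2 B hB hmB hy
          · rintro rfl
            refine ⟨Nat.lt_succ_of_le y.copy_le, fun h => absurd hmB (h B hB),
              fun B' hB' h1 h2 => ?_, fun _ _ _ _ => rfl⟩
            rw [huniq B' hB' h2] at h1
            exact absurd h1 hx
        · rintro ⟨B', hB', h1, -, h2⟩
          exact h2 (huniq B' hB' h1 ▸ hy)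
      · rw [if_pos ⟨B, hB, hmB, hx, hy⟩, Finset.filter_true_of_mem, Finset.card_range]
        intro c _
        refine ⟨fun h => absurd hmB (h B hB), fun B' hB' h1 h2 => ?_, fun B' hB' h1 h2 => ?_⟩
        · rw [huniq B' hB' h2] at h1
          exact absurd h1 hx
        · rw [huniq B' hB' h1] at h2
          exact absurd h2 hy
  · have hB' : ∀ B ∈ 𝓑.blocks, m ∉ B := fun B h1 h2 => hB ⟨B, h1, h2⟩
    rw [if_neg, Finset.card_eq_one]
    · refine ⟨0, ?_⟩
      ext c
      simp only [Finset.mem_filter, Finset.mem_range, Finset.mem_singleton]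
      constructor
      · exact fun h => h.2.1 hB'
      · rintro rfl
        exact ⟨by omega, fun _ => rfl, fun B h1 _ h2 => absurd h2 (hB' B h1),
          fun B h1 h2 => absurd h2 (hB' B h1)⟩
    · rintro ⟨B, h1, h2, -⟩
      exact hB' B h1 h2

instance : GradeMinOrder ℕ (BlockPoset 𝓑 K) where
  grade := rank
  grade_strictMono x y h := h.1
  covBy_grade {x y} h := by
    classical
    rw [Nat.covBy_iff_add_one_eq]
    by_contra hne
    have hlt : x.rank + 1 < y.rank := lt_of_le_of_ne h.lt.1 hne
    have hcard := card_between h.lt (Nat.lt_succ_self _) hlt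
    have hpos : 0 < (Finset.univ.filter fun z =>
        (x < z ∧ z < y) ∧ z.rank = x.rank + 1).card := by
      rw [hcard]
      split_ifs <;> omega
    obtain ⟨z, hz⟩ := Finset.card_pos.1 hpos
    have hz := (Finset.mem_filter.1 hz).2.1
    exact h.2 hz.1 hz.2
  isMin_grade x hx := by
    have : x = ⊥ := hx.eq_bot
    rw [this]
    exact isMin_bot

theorem grade_eq (x : BlockPoset 𝓑 K) : grade ℕ x = x.rank := rfl

end BlockPoset

theorem sum_Ico_neg_one_pow_even (a k : ℕ) :
    ∑ m ∈ Finset.Ico a (a + 2 * k), (-1 : ℤ) ^ m = 0 := by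
  induction k with
  | zero => simp
  | succ k ih =>
    rw [show a + 2 * (k + 1) = a + 2 * k + 1 + 1 by ring, Finset.sum_Ico_succ_top (by omega),
      Finset.sum_Ico_succ_top (by omega), ih]
    ring

theorem two_mul_sum_Ioo_neg_one_pow {i j : ℕ} (h : i < j) :
    2 * ∑ m ∈ Finset.Ioo i j, (-1 : ℤ) ^ m = -(-1) ^ i - (-1) ^ j := by
  obtain ⟨k, rfl⟩ := Nat.exists_eq_add_of_lt h
  have : Finset.Ioo i (i + k + 1) = Finset.Ico (i + 1) (i + 1 + k) := by
    ext m; simp only [Finset.mem_Ioo, Finset.mem_Ico]; omega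
  rw [this]
  clear this h
  induction k with
  | zero => simp [pow_succ]
  | succ k ih =>
    rw [← add_assoc, Finset.sum_Ico_succ_top (by omega), mul_add, ih]
    ring

namespace BlockPoset

variable {n : ℕ} {𝓑 : BlockSystem n} {K : ℕ}

/-- In an interval `[x, y]` the ranks with more than two elements form whole blocks, and even
blocks do not contribute to the alternating sum. -/
theorem isEulerian : IsEulerian (BlockPoset 𝓑 K) := by
  classical
  refine isEulerian_of_sum_neg_one_pow_grade fun x y hxy => ?_
  have hr := hxy.1
  have h1 : (Finset.univ.filter fun z => x ≤ z ∧ z ≤ y) =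
      insert x (insert y (Finset.univ.filter fun z => x < z ∧ z < y)) := by
    ext z
    simp only [Finset.mem_filter, Finset.mem_univ, true_and, Finset.mem_insert]
    constructor
    · rintro ⟨h1, h2⟩
      rcases h1.eq_or_lt with rfl | h1
      · exact Or.inl rfl
      rcases h2.eq_or_lt with rfl | h2
      · exact Or.inr (Or.inl rfl)
      exact Or.inr (Or.inr ⟨h1, h2⟩)
    · rintro (rfl | rfl | h1)
      · exact ⟨le_rfl, hxy.le⟩
      · exact ⟨hxy.le, le_rfl⟩
      · exact ⟨h1.1.le, h1.2.le⟩
  rw [h1, Finset.sum_insert (by simp [hxy.ne]), Finset.sum_insert (by simp),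
    ← Finset.sum_fiberwise_of_maps_to (t := Finset.Ioo x.rank y.rank) (g := rank)
      (fun z hz => Finset.mem_Ioo.2
        ⟨(Finset.mem_filter.1 hz).2.1.1, (Finset.mem_filter.1 hz).2.2.1⟩)]
  have h2 : ∀ m ∈ Finset.Ioo x.rank y.rank,
      ∑ z ∈ (Finset.univ.filter fun z => x < z ∧ z < y) with z.rank = m, (-1 : ℤ) ^ grade ℕ z =
        2 * (-1) ^ m + 2 * K *
          if ∃ B ∈ 𝓑.blocks, m ∈ B ∧ x.rank ∉ B ∧ y.rank ∉ B then (-1) ^ m else 0 := by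
    intro m hm
    rw [Finset.mem_Ioo] at hm
    rw [Finset.filter_filter, Finset.sum_congr rfl (g := fun _ => (-1 : ℤ) ^ m),
      Finset.sum_const, card_between hxy hm.1 hm.2, nsmul_eq_mul]
    · split_ifs <;> push_cast <;> ring
    · intro z hz
      rw [grade_eq, (Finset.mem_filter.1 hz).2.2]
  rw [Finset.sum_congr rfl h2, Finset.sum_add_distrib, ← Finset.mul_sum, ← Finset.mul_sum,
    two_mul_sum_Ioo_neg_one_pow hr, ← Finset.sum_filter]
  have h3 : (Finset.Ioo x.rank y.rank).filter
      (fun m => ∃ B ∈ 𝓑.blocks, m ∈ B ∧ x.rank ∉ B ∧ y.rank ∉ B) =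
      (𝓑.blocks.filter fun B => B ⊆ Finset.Ioo x.rank y.rank).biUnion id := by
    ext m
    simp only [Finset.mem_filter, Finset.mem_biUnion, id]
    constructor
    · rintro ⟨hm, B, hB, hmB, hx, hy⟩
      refine ⟨B, ⟨hB, ?_⟩, hmB⟩
      intro t ht
      rw [Finset.mem_Ioo] at hm ⊢
      constructor
      · by_contra hlt
        exact hx (mem_of_between hB ht hmB (not_lt.1 hlt) hm.1.le)
      · by_contra hlt
        exact hy (mem_of_between hB hmB ht hm.2.le (not_lt.1 hlt))
    · rintro ⟨B, ⟨hB, hsub⟩, hmB⟩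
      exact ⟨hsub hmB, B, hB, hmB, fun h => by simpa using hsub h, fun h => by simpa using hsub h⟩
  rw [h3, Finset.sum_biUnion, Finset.sum_eq_zero]
  · simp only [grade_eq]
    ring
  · intro B hB
    obtain ⟨a, b, hab, rfl, k, hk⟩ := 𝓑.interval B (Finset.mem_filter.1 hB).1
    rw [Nat.card_Icc] at hk
    have : Finset.Icc a b = Finset.Ico a (a + 2 * k) := by
      ext m; simp only [Finset.mem_Icc, Finset.mem_Ico]; omega
    exact this ▸ sum_Ico_neg_one_pow_even a k
  · intro B hB B' hB' hne
    rw [Function.onFun, id, id, Finset.disjoint_left]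
    intro i hi hi'
    exact hne (𝓑.eq_of_mem _ (Finset.mem_filter.1 hB).1 _ (Finset.mem_filter.1 hB').1 i hi hi')

open Classical in
/-- Each rank contributes a factor two, and each block met by the chains contributes the number of
copies, unless the copy is prescribed by the upper end. -/
theorem chainsBelow_eq {T : Finset ℕ} (hT : T ⊆ Finset.Icc 1 n) (y : BlockPoset 𝓑 K)
    (hy : ∀ t ∈ T, t < y.rank) :
    chainsBelow T y = 2 ^ T.card *
      (K + 1) ^ (𝓑.blocks.filter fun B => ¬ Disjoint T B ∧ y.rank ∉ B).card := by
  induction T using Finset.induction_on_max generalizing y with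
  | empty =>
    rw [chainsBelow_empty]
    simp
  | insert j T hmax ih =>
    have hj := Finset.mem_Icc.1 (hT (Finset.mem_insert_self _ _))
    have hjy := hy j (Finset.mem_insert_self _ _)
    have hjT : j ∉ T := fun h => lt_irrefl _ (hmax j h)
    have hTn : T ⊆ Finset.Icc 1 n := (Finset.subset_insert _ _).trans hT
    rw [chainsBelow_insert hmax, Finset.sum_congr rfl (g := fun _ => 2 ^ T.card *
      (K + 1) ^ (𝓑.blocks.filter fun B => ¬ Disjoint T B ∧ j ∉ B).card), Finset.sum_const]
    swap
    · intro z hz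
      have hz : z.rank = j := (Finset.mem_filter.1 hz).2.2
      rw [ih hTn z (by rw [hz]; exact hmax), hz]
    have h1 : (Finset.univ.filter fun z => z < y ∧ grade ℕ z = j) =
        Finset.univ.filter fun z => (⊥ < z ∧ z < y) ∧ z.rank = j := by
      refine Finset.filter_congr fun z _ => ?_
      simp only [grade_eq]
      constructor
      · rintro ⟨h1, h2⟩
        refine ⟨⟨bot_lt_iff_ne_bot.2 ?_, h1⟩, h2⟩
        rintro rfl
        rw [rank_bot] at h2
        omega
      · exact fun h => ⟨h.1.2, h.2⟩
    have hbot : (⊥ : BlockPoset 𝓑 K) < y := by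
      rw [bot_lt_iff_ne_bot]
      rintro rfl
      rw [rank_bot] at hjy
      omega
    rw [h1, card_between hbot (by rw [rank_bot]; omega) hjy, Finset.card_insert_of_notMem hjT,
      smul_eq_mul, rank_bot]
    have hlow : ∀ B ∈ 𝓑.blocks, ¬ Disjoint T B → y.rank ∈ B → j ∈ B := by
      intro B hB h1 h2
      obtain ⟨t, ht, htB⟩ := Finset.not_disjoint_iff.1 h1
      exact mem_of_between hB htB h2 (hmax t ht).le hjy.le
    split_ifs with hB
    · obtain ⟨B, hB, hjB, -, hyB⟩ := hB
      have : (𝓑.blocks.filter fun B => ¬ Disjoint (insert j T) B ∧ y.rank ∉ B) =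
          insert B (𝓑.blocks.filter fun B => ¬ Disjoint T B ∧ j ∉ B) := by
        ext C
        simp only [Finset.mem_filter, Finset.mem_insert, Finset.disjoint_insert_left]
        constructor
        · rintro ⟨hC, h1, h2⟩
          by_cases hjC : j ∈ C
          · exact Or.inl (𝓑.eq_of_mem _ hC _ hB j hjC hjB)
          · exact Or.inr ⟨hC, fun h => h1 ⟨hjC, h⟩, hjC⟩
        · rintro (rfl | ⟨hC, h1, h2⟩)
          · exact ⟨hB, fun h => h.1 hjB, hyB⟩
          · exact ⟨hC, fun h => h1 h.2, fun h => h2 (hlow C hC h1 h)⟩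
      rw [this, Finset.card_insert_of_notMem (by simp [hjB])]
      ring
    · have : (𝓑.blocks.filter fun B => ¬ Disjoint (insert j T) B ∧ y.rank ∉ B) =
          (𝓑.blocks.filter fun B => ¬ Disjoint T B ∧ j ∉ B) := by
        refine Finset.filter_congr fun C hC => ?_
        rw [Finset.disjoint_insert_left]
        constructor
        · rintro ⟨h1, h2⟩
          have hjC : j ∉ C := fun hjC => hB ⟨C, hC, hjC, zero_notMem hC, h2⟩
          exact ⟨fun h => h1 ⟨hjC, h⟩, hjC⟩
        · rintro ⟨h1, h2⟩
          exact ⟨fun h => h1 h.2, fun h => h2 (hlow C hC h1 h)⟩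
      rw [this]
      ring

open Classical in
theorem flagVector_apply (T : ↥((Finset.Icc 1 n).powerset)) :
    flagVector n (BlockPoset 𝓑 K) T =
      2 ^ T.1.card * (K + 1) ^ (𝓑.blocks.filter fun B => ¬ Disjoint T.1 B).card := by
  have hT := Finset.mem_powerset.1 T.2
  rw [flagVector, flagF_eq_chainsBelow_top (n := n) rfl hT, chainsBelow_eq hT]
  · rw [Finset.filter_congr (q := fun B => ¬ Disjoint T.1 B)]
    · push_cast
      rfl
    · exact fun B hB => and_iff_left (succ_notMem hB)
  · intro t ht
    have := Finset.mem_Icc.1 (hT ht)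
    rw [rank_top]
    omega

end BlockPoset

open Classical in
/-- The limit of the normalized flag vectors of the posets of a block system, as the number of
copies tends to infinity. -/
noncomputable def BlockSystem.limitVector {n : ℕ} (𝓑 : BlockSystem n) : FlagSpace n :=
  fun T => if ∀ B ∈ 𝓑.blocks, ¬ Disjoint T.1 B then 2 ^ T.1.card else 0

open Filter Topology in
theorem BlockSystem.limitVector_mem_eulerianCone {n : ℕ} (𝓑 : BlockSystem n) :
    𝓑.limitVector ∈ eulerianCone n := by
  classical
  have hmem : ∀ K : ℕ, (1 / ((K : ℝ) + 1)) ^ 𝓑.blocks.card • flagVector n (BlockPoset 𝓑 K) ∈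
      (PointedCone.hull ℝ (eulerianFlagVectors n) : Set (FlagSpace n)) := by
    intro K
    have h1 : flagVector n (BlockPoset 𝓑 K) ∈ PointedCone.hull ℝ (eulerianFlagVectors n) :=
      Submodule.subset_span ⟨BlockPoset 𝓑 K, inferInstance, inferInstance, inferInstance,
        inferInstance, rfl, BlockPoset.isEulerian, rfl⟩
    exact (PointedCone.hull ℝ (eulerianFlagVectors n)).smul_mem
      (by positivity : (0 : ℝ) ≤ (1 / ((K : ℝ) + 1)) ^ 𝓑.blocks.card) h1
  refine mem_closure_of_tendsto (b := atTop) (tendsto_pi_nhds.2 fun T => ?_)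
    (Eventually.of_forall hmem)
  simp only [Pi.smul_apply, smul_eq_mul, BlockPoset.flagVector_apply]
  have hle : (𝓑.blocks.filter fun B => ¬ Disjoint T.1 B).card ≤ 𝓑.blocks.card :=
    Finset.card_filter_le _ _
  have heq : ∀ K : ℕ, (1 / ((K : ℝ) + 1)) ^ 𝓑.blocks.card * (2 ^ T.1.card *
      ((K : ℝ) + 1) ^ (𝓑.blocks.filter fun B => ¬ Disjoint T.1 B).card) = 2 ^ T.1.card *
      (1 / ((K : ℝ) + 1)) ^
        (𝓑.blocks.card - (𝓑.blocks.filter fun B => ¬ Disjoint T.1 B).card) := by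
    intro K
    obtain ⟨d, hd⟩ := Nat.exists_eq_add_of_le hle
    have hK : ((K : ℝ) + 1) ≠ 0 := by positivity
    rw [hd, Nat.add_sub_cancel_left, pow_add]
    rw [one_div, inv_pow, inv_pow]
    field_simp
  simp only [heq]
  rw [BlockSystem.limitVector]
  split_ifs with h
  · rw [Finset.filter_true_of_mem h, Nat.sub_self]
    simp
  · have hlt : (𝓑.blocks.filter fun B => ¬ Disjoint T.1 B).card < 𝓑.blocks.card := by
      refine lt_of_le_of_ne hle fun h' => h ?_
      have := Finset.eq_of_subset_of_card_le (Finset.filter_subset _ _) h'.ge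
      intro B hB
      rw [← this] at hB
      exact (Finset.mem_filter.1 hB).2
    have h0 : Tendsto (fun K : ℕ => 1 / ((K : ℝ) + 1)) atTop (𝓝 0) :=
      tendsto_one_div_add_atTop_nhds_zero_nat
    have := ((h0.pow (𝓑.blocks.card -
      (𝓑.blocks.filter fun B => ¬ Disjoint T.1 B).card)).const_mul ((2 : ℝ) ^ T.1.card))
    rwa [zero_pow (by omega), mul_zero] at this

open Classical in
theorem BlockSystem.limitVector_eq_sum {n : ℕ} (𝓑 : BlockSystem n) :
    𝓑.limitVector = ∑ J ∈ 𝓑.blocks.powerset, (-1 : ℝ) ^ J.card • dualVector n (J.biUnion id) := by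
  funext T
  have h1 : 𝓑.limitVector T = 2 ^ T.1.card *
      ∏ B ∈ 𝓑.blocks, ((if Disjoint T.1 B then (-1 : ℝ) else 0) + 1) := by
    rw [limitVector]
    split_ifs with h
    · rw [Finset.prod_eq_one, mul_one]
      intro B hB
      rw [if_neg (h B hB), zero_add]
    · push Not at h
      obtain ⟨B, hB, hd⟩ := h
      rw [Finset.prod_eq_zero hB, mul_zero]
      rw [if_pos hd]
      norm_num
  rw [h1, Finset.prod_add, Finset.sum_apply, Finset.mul_sum]
  refine Finset.sum_congr rfl fun J _ => ?_
  rw [Finset.prod_const_one, mul_one, Pi.smul_apply, smul_eq_mul, dualVector]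
  split_ifs with h <;> rw [Finset.disjoint_biUnion_right] at h
  · rw [Finset.prod_congr rfl (g := fun _ => (-1 : ℝ)), Finset.prod_const]
    · ring
    · exact fun B hB => if_pos (h B hB)
  · push Not at h
    obtain ⟨B, hB, hd⟩ := h
    rw [Finset.prod_eq_zero hB (if_neg hd)]
    ring

/-! ### Maximal intervals and dominoes -/

theorem exists_isMaxInterval {S : Finset ℕ} {m : ℕ} (hm : m ∈ S) :
    ∃ a b, IsMaxInterval S a b ∧ a ≤ m ∧ m ≤ b := by
  classical
  have h1 : ∃ a, a ≤ m ∧ Finset.Icc a m ⊆ S := ⟨m, le_rfl, by simpa using hm⟩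
  have h2 : ∃ b, m ≤ b ∧ b + 1 ∉ S := by
    refine ⟨max m (S.sup id), le_max_left _ _, fun h => ?_⟩
    have h3 : max m (S.sup id) + 1 ≤ S.sup id := Finset.le_sup (f := id) h
    have := le_max_right m (S.sup id)
    omega
  have hb := Nat.find_spec h2
  refine ⟨Nat.find h1, Nat.find h2, isMaxInterval_of_boundary ?_ ?_ ?_ hb.2,
    (Nat.find_spec h1).1, hb.1⟩
  · exact (Nat.find_spec h1).1.trans hb.1
  · intro t ht
    rw [Finset.mem_Icc] at ht
    rcases le_or_gt t m with h3 | h3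
    · exact (Nat.find_spec h1).2 (Finset.mem_Icc.2 ⟨ht.1, h3⟩)
    · have h4 := Nat.find_min h2 (m := t - 1) (by omega)
      rw [Nat.sub_add_cancel (by omega)] at h4
      by_contra h5
      exact h4 ⟨by omega, h5⟩
  · intro c hc hcS
    refine Nat.find_min h1 (m := c) (by omega) ⟨by have := (Nat.find_spec h1).1; omega, ?_⟩
    intro t ht
    rw [Finset.mem_Icc] at ht
    rcases ht.1.eq_or_lt with rfl | h3
    · exact hcS
    · exact (Nat.find_spec h1).2 (Finset.mem_Icc.2 ⟨by omega, ht.2⟩)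

theorem IsMaxInterval.eq_of_mem {S : Finset ℕ} {a b c d m : ℕ} (h : IsMaxInterval S a b)
    (h' : IsMaxInterval S c d) (hm : a ≤ m ∧ m ≤ b) (hm' : c ≤ m ∧ m ≤ d) : a = c ∧ b = d := by
  refine ⟨?_, ?_⟩
  · rcases Nat.lt_trichotomy a c with h1 | h1 | h1
    · exact absurd (h.2.1 (Finset.mem_Icc.2 ⟨by omega, by omega⟩))
        (h'.pred_notMem (c := c - 1) (by omega))
    · exact h1
    · exact absurd (h'.2.1 (Finset.mem_Icc.2 ⟨by omega, by omega⟩))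
        (h.pred_notMem (c := a - 1) (by omega))
  · rcases Nat.lt_trichotomy b d with h1 | h1 | h1
    · exact absurd (h'.2.1 (Finset.mem_Icc.2 ⟨by omega, by omega⟩)) h.succ_notMem
    · exact h1
    · exact absurd (h.2.1 (Finset.mem_Icc.2 ⟨by omega, by omega⟩)) h'.succ_notMem

/-- `D` is the set of left ends of a decomposition of `S` into disjoint pairs `{d, d + 1}`. -/
structure IsDominoSet (S D : Finset ℕ) : Prop where
  mem : ∀ d ∈ D, d ∈ S
  succ_mem : ∀ d ∈ D, d + 1 ∈ S
  succ_notMem : ∀ d ∈ D, d + 1 ∉ D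
  cover : ∀ m ∈ S, m ∈ D ∨ ∃ d ∈ D, m = d + 1

theorem IsEvenSet.exists_isDominoSet {S : Finset ℕ} (h : IsEvenSet S) :
    ∃ D, IsDominoSet S D := by
  classical
  refine ⟨S.filter fun m => ∃ a b, IsMaxInterval S a b ∧ a ≤ m ∧ m ≤ b ∧ Even (m - a), ?_⟩
  have hlt : ∀ {a b m : ℕ}, IsMaxInterval S a b → a ≤ m → m ≤ b → Even (m - a) → m < b := by
    intro a b m hab h1 h2 h3
    refine lt_of_le_of_ne h2 ?_
    rintro rfl
    have := h a m hab
    rw [Nat.card_Icc] at this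
    rw [Nat.even_iff] at *
    omega
  refine ⟨fun d hd => (Finset.mem_filter.1 hd).1, fun d hd => ?_, fun d hd hd' => ?_,
    fun m hm => ?_⟩
  · obtain ⟨-, a, b, hab, h1, h2, h3⟩ := Finset.mem_filter.1 hd
    exact hab.2.1 (Finset.mem_Icc.2 ⟨by omega, hlt hab h1 h2 h3⟩)
  · obtain ⟨-, a, b, hab, h1, h2, h3⟩ := Finset.mem_filter.1 hd
    obtain ⟨-, a', b', hab', h1', h2', h3'⟩ := Finset.mem_filter.1 hd'
    have := hlt hab h1 h2 h3
    obtain ⟨rfl, rfl⟩ := hab.eq_of_mem hab' (m := d + 1) ⟨by omega, by omega⟩ ⟨h1', h2'⟩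
    rw [Nat.even_iff] at *
    omega
  · obtain ⟨a, b, hab, h1, h2⟩ := exists_isMaxInterval hm
    by_cases h3 : Even (m - a)
    · exact Or.inl (Finset.mem_filter.2 ⟨hm, a, b, hab, h1, h2, h3⟩)
    · have hne : m ≠ a := by
        rintro rfl
        simp at h3
      refine Or.inr ⟨m - 1, Finset.mem_filter.2 ⟨hab.2.1 (Finset.mem_Icc.2
        ⟨by omega, by omega⟩), a, b, hab, by omega, by omega, ?_⟩, by omega⟩
      rw [Nat.even_iff] at *
      omega

theorem IsDominoSet.isEvenSet {S D : Finset ℕ} (h : IsDominoSet S D) : IsEvenSet S := by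
  intro a b hab
  have hle := hab.1
  have key : ∀ k, a + k ≤ b → (a + k ∈ D ↔ Even k) := by
    intro k
    induction k with
    | zero =>
      intro _
      simp only [add_zero, Even.zero, iff_true]
      rcases h.cover a (hab.2.1 (Finset.mem_Icc.2 ⟨le_rfl, hle⟩)) with h1 | ⟨d, hd, rfl⟩
      · exact h1
      · exact absurd (h.mem d hd) (hab.pred_notMem rfl)
    | succ k ih =>
      intro hk
      have ih := ih (by omega)
      rw [Nat.even_add_one, ← ih, ← add_assoc]
      constructor
      · exact fun h1 h2 => h.succ_notMem _ h2 h1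
      · intro h1
        rcases h.cover (a + k + 1) (hab.2.1 (Finset.mem_Icc.2 ⟨by omega, by omega⟩)) with
          h2 | ⟨d, hd, h2⟩
        · exact h2
        · obtain rfl : d = a + k := by omega
          exact absurd hd h1
  have hb : b ∉ D := fun hb => hab.succ_notMem (h.succ_mem b hb)
  have := key (b - a) (by omega)
  rw [Nat.add_sub_cancel' hle] at this
  rw [Nat.card_Icc]
  have h1 := mt this.2 hb
  rw [Nat.even_iff] at *
  omega

/-- The block system of the maximal intervals of an even set. -/
theorem IsEvenSet.exists_maxIntervalSystem {n : ℕ} {S : Finset ℕ} (hS : S ⊆ Finset.Icc 1 n)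
    (h : IsEvenSet S) : ∃ 𝓑 : BlockSystem n, 𝓑.blocks.biUnion id = S ∧
      ∀ B ∈ 𝓑.blocks, ∃ a b, IsMaxInterval S a b ∧ B = Finset.Icc a b := by
  classical
  refine ⟨⟨S.powerset.filter fun B => ∃ a b, IsMaxInterval S a b ∧ B = Finset.Icc a b,
    ?_, ?_, ?_⟩, ?_, ?_⟩
  · intro B hB B' hB' i hi hi'
    obtain ⟨-, a, b, hab, rfl⟩ := Finset.mem_filter.1 hB
    obtain ⟨-, c, d, hcd, rfl⟩ := Finset.mem_filter.1 hB'
    obtain ⟨rfl, rfl⟩ := hab.eq_of_mem hcd (Finset.mem_Icc.1 hi) (Finset.mem_Icc.1 hi')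
    rfl
  · intro B hB
    obtain ⟨-, a, b, hab, rfl⟩ := Finset.mem_filter.1 hB
    exact ⟨a, b, hab.1, rfl, h a b hab⟩
  · exact fun B hB => (Finset.mem_powerset.1 (Finset.mem_filter.1 hB).1).trans hS
  · ext m
    simp only [Finset.mem_biUnion, Finset.mem_filter, Finset.mem_powerset, id]
    constructor
    · rintro ⟨B, ⟨hB, -⟩, hm⟩
      exact hB hm
    · intro hm
      obtain ⟨a, b, hab, h1, h2⟩ := exists_isMaxInterval hm
      exact ⟨Finset.Icc a b, ⟨hab.2.1, a, b, hab, rfl⟩, Finset.mem_Icc.2 ⟨h1, h2⟩⟩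
  · exact fun B hB => (Finset.mem_filter.1 hB).2

/-- The block system of a decomposition into pairs. -/
theorem IsDominoSet.exists_dominoSystem {n : ℕ} {S D : Finset ℕ} (hS : S ⊆ Finset.Icc 1 n)
    (h : IsDominoSet S D) : ∃ 𝓑 : BlockSystem n, 𝓑.blocks.biUnion id = S ∧
      ∀ d ∈ D, Finset.Icc d (d + 1) ∈ 𝓑.blocks := by
  classical
  have hmem : ∀ d ∈ D, ∀ i ∈ Finset.Icc d (d + 1), i ∈ S := by
    intro d hd i hi
    rw [Finset.mem_Icc] at hi
    obtain rfl | rfl : i = d ∨ i = d + 1 := by omega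
    · exact h.mem _ hd
    · exact h.succ_mem _ hd
  refine ⟨⟨D.image fun d => Finset.Icc d (d + 1), ?_, ?_, ?_⟩, ?_, ?_⟩
  · intro B hB B' hB' i hi hi'
    obtain ⟨d, hd, rfl⟩ := Finset.mem_image.1 hB
    obtain ⟨e, he, rfl⟩ := Finset.mem_image.1 hB'
    rw [Finset.mem_Icc] at hi hi'
    obtain rfl | rfl | rfl : d = e ∨ d = e + 1 ∨ e = d + 1 := by omega
    · rfl
    · exact absurd hd (h.succ_notMem _ he)
    · exact absurd he (h.succ_notMem _ hd)
  · intro B hB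
    obtain ⟨d, hd, rfl⟩ := Finset.mem_image.1 hB
    exact ⟨d, d + 1, by omega, rfl, by rw [Nat.card_Icc]; exact ⟨1, by omega⟩⟩
  · intro B hB
    obtain ⟨d, hd, rfl⟩ := Finset.mem_image.1 hB
    exact fun i hi => hS (hmem d hd i hi)
  · ext m
    simp only [Finset.mem_biUnion, Finset.mem_image, id]
    constructor
    · rintro ⟨B, ⟨d, hd, rfl⟩, hm⟩
      exact hmem d hd m hm
    · intro hm
      rcases h.cover m hm with hd | ⟨d, hd, rfl⟩
      · exact ⟨_, ⟨m, hd, rfl⟩, by simp⟩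
      · exact ⟨_, ⟨d, hd, rfl⟩, by simp⟩
  · exact fun d hd => Finset.mem_image_of_mem _ hd

/-! ### The forms on the limit vectors -/

theorem BlockSystem.wordForm_limitVector {n : ℕ} (𝓑 : BlockSystem n) {M V : Finset ℕ}
    (hMV : M ⊆ V) (hV : V ⊆ Finset.Icc 1 n) :
    wordForm n (facetAlpha V) (facetBeta M V) 𝓑.limitVector =
      ∑ J ∈ 𝓑.blocks.powerset,
        (-1) ^ J.card * if M ⊆ J.biUnion id ∧ J.biUnion id ⊆ V then 1 else 0 := by
  classical
  change wordFormLM n (facetAlpha V) (facetBeta M V) 𝓑.limitVector = _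
  rw [𝓑.limitVector_eq_sum, map_sum]
  refine Finset.sum_congr rfl fun J hJ => ?_
  rw [map_smul, smul_eq_mul]
  congr 1
  have hJn : J.biUnion id ⊆ Finset.Icc 1 n := Finset.biUnion_subset.2 fun B hB =>
    𝓑.subset_range B (Finset.mem_powerset.1 hJ hB)
  convert wordForm_facet_dualVector hMV hV hJn
  rfl

theorem BlockSystem.flagL_limitVector_ne_zero {n : ℕ} (𝓑 : BlockSystem n) :
    flagL n (𝓑.blocks.biUnion id) 𝓑.limitVector ≠ 0 := by
  classical
  have hS : 𝓑.blocks.biUnion id ⊆ Finset.Icc 1 n := Finset.biUnion_subset.2 𝓑.subset_range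
  rw [flagL_eq_wordForm hS, 𝓑.wordForm_limitVector subset_rfl hS,
    Finset.sum_eq_single_of_mem 𝓑.blocks (Finset.mem_powerset_self _)]
  · simp
  · intro J hJ hne
    rw [if_neg, mul_zero]
    rintro ⟨h, -⟩
    have hJ := Finset.mem_powerset.1 hJ
    refine hne (hJ.antisymm fun B hB => ?_)
    obtain ⟨a, b, hab, hBab, -⟩ := 𝓑.interval B hB
    have haB : a ∈ B := hBab ▸ Finset.mem_Icc.2 ⟨le_rfl, hab⟩
    obtain ⟨C, hC, haC⟩ := Finset.mem_biUnion.1 (h (Finset.mem_biUnion.2 ⟨B, hB, haB⟩))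
    rwa [𝓑.eq_of_mem B hB C (hJ hC) a haB haC]

theorem BlockSystem.flagL_limitVector_eq_zero {n : ℕ} (𝓑 : BlockSystem n) {Q : Finset ℕ}
    (hQ : Q ⊆ Finset.Icc 1 n) (hQS : ¬ Q ⊆ 𝓑.blocks.biUnion id) :
    flagL n Q 𝓑.limitVector = 0 := by
  classical
  rw [flagL_eq_wordForm hQ, 𝓑.wordForm_limitVector subset_rfl hQ]
  refine Finset.sum_eq_zero fun J hJ => ?_
  rw [if_neg, mul_zero]
  exact fun h => hQS (h.1.trans
    (Finset.biUnion_subset_biUnion_of_subset_left _ (Finset.mem_powerset.1 hJ)))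

/-- Adding a block contained in `V \ M` to a subfamily changes only its sign. -/
theorem BlockSystem.facetForm_limitVector_eq_zero_of_disjoint {n : ℕ} (𝓑 : BlockSystem n)
    {M V B : Finset ℕ} (hMV : M ⊆ V) (hV : V ⊆ Finset.Icc 1 n) (hB : B ∈ 𝓑.blocks)
    (hBV : B ⊆ V) (hBM : Disjoint M B) : facetForm n M V 𝓑.limitVector = 0 := by
  classical
  rw [facetForm_eq_wordForm hMV hV, 𝓑.wordForm_limitVector hMV hV, ← Finset.insert_erase hB,
    Finset.sum_powerset_insert (Finset.notMem_erase _ _), ← Finset.sum_add_distrib,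
    Finset.sum_eq_zero, mul_zero]
  intro J hJ
  have hBJ : B ∉ J := fun h => Finset.notMem_erase _ _ (Finset.mem_powerset.1 hJ h)
  have : (M ⊆ (insert B J).biUnion id ∧ (insert B J).biUnion id ⊆ V) ↔
      (M ⊆ J.biUnion id ∧ J.biUnion id ⊆ V) := by
    rw [Finset.biUnion_insert, Finset.union_subset_iff]
    simp only [id, hBV, true_and]
    refine and_congr_left fun _ => ⟨fun h m hm => ?_, fun h => h.trans Finset.subset_union_right⟩
    exact (Finset.mem_union.1 (h hm)).resolve_left (Finset.disjoint_left.1 hBM hm)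
  rw [Finset.card_insert_of_notMem hBJ]
  simp only [this]
  ring

theorem BlockSystem.facetForm_limitVector_eq_zero_of_mem {n : ℕ} (𝓑 : BlockSystem n)
    {M V : Finset ℕ} {m : ℕ} (hMV : M ⊆ V) (hV : V ⊆ Finset.Icc 1 n) (hm : m ∈ M)
    (hB : ∀ B ∈ 𝓑.blocks, m ∈ B → ¬ B ⊆ V) : facetForm n M V 𝓑.limitVector = 0 := by
  classical
  rw [facetForm_eq_wordForm hMV hV, 𝓑.wordForm_limitVector hMV hV, Finset.sum_eq_zero, mul_zero]
  intro J hJ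
  rw [if_neg, mul_zero]
  rintro ⟨h1, h2⟩
  obtain ⟨B, hBJ, hmB⟩ := Finset.mem_biUnion.1 (h1 hm)
  exact hB B (Finset.mem_powerset.1 hJ hBJ) hmB fun i hi => h2 (Finset.mem_biUnion.2 ⟨B, hBJ, hi⟩)

/-! ### The combinatorics of the pairs `(M, V)` -/

namespace IsFacetPair

variable {n : ℕ} {M V : Finset ℕ}

/-- In an interval of `V` that meets `M`, the set `M` is a pair of consecutive numbers. -/
theorem exists_pair (h : IsFacetPair n M V) {m : ℕ} (hm : m ∈ M) :
    ∃ a b p, IsMaxInterval V a b ∧ a ≤ p ∧ p + 1 ≤ b ∧ M ∩ Finset.Icc a b = Finset.Icc p (p + 1) ∧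
      p ≤ m ∧ m ≤ p + 1 := by
  obtain ⟨a, b, hab, h1, h2⟩ := exists_isMaxInterval (h.subset hm)
  have hcard := h.two_le_card a b hab
  rw [Nat.card_Icc] at hcard
  have hmem : m ∈ M ∩ Finset.Icc a b := Finset.mem_inter.2 ⟨hm, Finset.mem_Icc.2 ⟨h1, h2⟩⟩
  rcases h.inter a b hab with hM | hM | hM
  · rw [hM] at hmem
    simp at hmem
  · have := Finset.mem_Icc.1 (hM ▸ hmem)
    exact ⟨a, b, a, hab, le_rfl, by omega, hM, this.1, this.2⟩
  · have := Finset.mem_Icc.1 (hM ▸ hmem)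
    refine ⟨a, b, b - 1, hab, by omega, by omega, ?_, this.1, by omega⟩
    rw [hM, Nat.sub_add_cancel (by omega)]

theorem isDominoSet (h : IsFacetPair n M V) : IsDominoSet M (M.filter (· + 1 ∈ M)) := by
  refine ⟨fun d hd => (Finset.mem_filter.1 hd).1, fun d hd => (Finset.mem_filter.1 hd).2,
    fun d hd hd' => ?_, fun m hm => ?_⟩
  · rw [Finset.mem_filter] at hd hd'
    obtain ⟨a, b, p, hab, h1, h2, hM, h3, h4⟩ := h.exists_pair hd'.1
    have ha : a ≤ d := by
      by_contra hlt
      exact hab.pred_notMem (c := d) (by omega) (h.subset hd.1)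
    have hb : d + 1 + 1 ≤ b := by
      by_contra hlt
      obtain rfl : b = d + 1 := by omega
      exact hab.succ_notMem (h.subset hd'.2)
    have e1 : d ∈ Finset.Icc p (p + 1) :=
      hM ▸ Finset.mem_inter.2 ⟨hd.1, Finset.mem_Icc.2 ⟨ha, by omega⟩⟩
    have e2 : d + 1 + 1 ∈ Finset.Icc p (p + 1) :=
      hM ▸ Finset.mem_inter.2 ⟨hd'.2, Finset.mem_Icc.2 ⟨by omega, hb⟩⟩
    rw [Finset.mem_Icc] at e1 e2
    omega
  · obtain ⟨a, b, p, hab, h1, h2, hM, h3, h4⟩ := h.exists_pair hm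
    have e1 : p ∈ M := (Finset.mem_inter.1 (hM.ge (Finset.mem_Icc.2 ⟨le_rfl, by omega⟩))).1
    have e2 : p + 1 ∈ M := (Finset.mem_inter.1 (hM.ge (Finset.mem_Icc.2 ⟨by omega, le_rfl⟩))).1
    obtain rfl | rfl : m = p ∨ m = p + 1 := by omega
    · exact Or.inl (Finset.mem_filter.2 ⟨e1, e2⟩)
    · exact Or.inr ⟨p, Finset.mem_filter.2 ⟨e1, e2⟩, rfl⟩

/-- A pair of a decomposition of a set between `M` and `V` lies in `M` or is disjoint from `M`,
since the pairs of `M` are at the ends of intervals of `V`. -/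
theorem mem_iff_succ_mem (h : IsFacetPair n M V) {S D : Finset ℕ} (hMS : M ⊆ S) (hSV : S ⊆ V)
    (hD : IsDominoSet S D) {d : ℕ} (hd : d ∈ D) : d ∈ M ↔ d + 1 ∈ M := by
  obtain ⟨a, b, hab, h1, h2⟩ := exists_isMaxInterval (hSV (hD.mem d hd))
  have hb : d + 1 ≤ b := by
    by_contra hlt
    obtain rfl : b = d := by omega
    exact hab.succ_notMem (hSV (hD.succ_mem _ hd))
  have hM1 : d ∈ M ↔ d ∈ M ∩ Finset.Icc a b := by
    rw [Finset.mem_inter, Finset.mem_Icc]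
    tauto
  have hM2 : d + 1 ∈ M ↔ d + 1 ∈ M ∩ Finset.Icc a b := by
    rw [Finset.mem_inter, Finset.mem_Icc]
    exact ⟨fun h => ⟨h, by omega, hb⟩, fun h => h.1⟩
  rcases h.inter a b hab with hM | hM | hM
  · rw [hM1, hM2, hM]
    simp
  · have haM : a ∈ M := (Finset.mem_inter.1 (hM.ge (by simp))).1
    have haD : a ∈ D := by
      rcases hD.cover a (hMS haM) with h3 | ⟨c, hc, rfl⟩
      · exact h3
      · exact absurd (hSV (hD.mem c hc)) (hab.pred_notMem rfl)
    have hne : d ≠ a + 1 := by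
      rintro rfl
      exact hD.succ_notMem a haD hd
    rw [hM1, hM2, hM, Finset.mem_Icc, Finset.mem_Icc]
    omega
  · have hbM : b ∈ M := (Finset.mem_inter.1 (hM.ge (by simp))).1
    obtain ⟨c, hc, hbc⟩ : ∃ c ∈ D, b = c + 1 := by
      rcases hD.cover b (hMS hbM) with h3 | h3
      · exact absurd (hSV (hD.succ_mem b h3)) hab.succ_notMem
      · exact h3
    have hne : d + 1 ≠ c := by
      rintro rfl
      exact hD.succ_notMem d hd hc
    rw [hM1, hM2, hM, Finset.mem_Icc, Finset.mem_Icc]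
    omega

/-- If an even set containing `M` is not contained in `V`, then one of its maximal intervals that
leave `V` meets `M`: by the conditions on the pair, each number `s ∈ [1, n]` outside `V` is next to an
element of `M`, or both `s - 1` and `s + 1` are, unless they are `0` or `n + 1`. -/
theorem exists_mem_of_not_subset (h : IsFacetPair n M V) {S : Finset ℕ}
    (hS : S ⊆ Finset.Icc 1 n) (hev : IsEvenSet S) (hMS : M ⊆ S) {c d s : ℕ}
    (hcd : IsMaxInterval S c d) (hcs : c ≤ s) (hsd : s ≤ d) (hsV : s ∉ V) :
    ∃ m ∈ M, c ≤ m ∧ m ≤ d := by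
  by_contra hno
  push Not at hno
  have hlow : ∀ m ∈ M, m + 1 < c ∨ d < m := by
    intro m hm
    by_contra h1
    push Not at h1
    rcases h1.1.eq_or_lt with h2 | h2
    · exact hcd.pred_notMem h2.symm (hMS hm)
    · exact absurd (hno m hm (by omega)) (by omega)
  have hhigh : ∀ m ∈ M, m < c ∨ d + 1 < m := by
    intro m hm
    by_contra h1
    push Not at h1
    rcases h1.2.eq_or_lt with h2 | h2
    · subst h2
      exact hcd.succ_notMem (hMS hm)
    · exact absurd (hno m hm h1.1) (by omega)
  have hI : ∀ t, c ≤ t → t ≤ d → 1 ≤ t ∧ t ≤ n := fun t h1 h2 =>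
    Finset.mem_Icc.1 (hS (hcd.2.1 (Finset.mem_Icc.2 ⟨h1, h2⟩)))
  have hs := hI s hcs hsd
  have hmemG : ∀ t, t ∈ Finset.Icc 0 (n + 1) \ V ↔ t ≤ n + 1 ∧ t ∉ V := by
    intro t
    rw [Finset.mem_sdiff, Finset.mem_Icc]
    simp
  obtain ⟨g, e, hge, hgs, hse⟩ := exists_isMaxInterval ((hmemG s).2 ⟨by omega, hsV⟩)
  have hcard := h.gap_card_le g e hge
  rw [Nat.card_Icc] at hcard
  have hgap : ∀ t, g ≤ t → t ≤ e → t ≤ n + 1 ∧ t ∉ V := fun t h1 h2 =>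
    (hmemG t).1 (hge.2.1 (Finset.mem_Icc.2 ⟨h1, h2⟩))
  have hen := (hgap e (by omega) le_rfl).1
  -- the neighbours of the gap belong to `M`
  have hA : ∀ t, t + 1 = g → t ∈ M := by
    intro t ht
    have htV : t ∈ V := by
      by_contra h1
      exact hge.pred_notMem ht ((hmemG t).2 ⟨by omega, h1⟩)
    obtain ⟨a, b, hab, h1, h2⟩ := exists_isMaxInterval htV
    obtain rfl : b = t := by
      by_contra hne
      exact (hgap (t + 1) (by omega) (by omega)).2
        (hab.2.1 (Finset.mem_Icc.2 ⟨by omega, by omega⟩))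
    by_contra hbM
    rcases h.right a b hab hbM with h3 | h3
    · omega
    · have h4 : s = b + 1 := by
        by_contra hne
        exact (hgap (b + 2) (by omega) (by omega)).2 (h.subset h3)
      have := hhigh _ h3
      omega
  have hB : e ≤ n → e + 1 ∈ M := by
    intro hen'
    have htV : e + 1 ∈ V := by
      by_contra h1
      exact hge.succ_notMem ((hmemG _).2 ⟨by omega, h1⟩)
    obtain ⟨a, b, hab, h1, h2⟩ := exists_isMaxInterval htV
    obtain rfl : a = e + 1 := by
      by_contra hne
      exact (hgap e (by omega) le_rfl).2 (hab.2.1 (Finset.mem_Icc.2 ⟨by omega, by omega⟩))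
    by_contra haM
    rcases h.left _ b hab haM with h3 | ⟨m, hm, h3⟩
    · omega
    · have h4 : s = e := by
        by_contra hne
        exact (hgap m (by omega) (by omega)).2 (h.subset hm)
      have := hlow _ hm
      omega
  have hgs' : g < s := by
    refine lt_of_le_of_ne hgs ?_
    rintro rfl
    have := hlow _ (hA (g - 1) (by omega))
    omega
  have hse' : s < e := by
    refine lt_of_le_of_ne hse ?_
    rintro rfl
    have := hhigh _ (hB hs.2)
    omega
  -- now the gap is `{s - 1, s, s + 1}`, and the even interval `[c, d]` contains a neighbour of `s`
  have hlt : c < d := by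
    have := hev c d hcd
    rw [Nat.card_Icc, Nat.even_iff] at this
    omega
  rcases hsd.eq_or_lt with h1 | h1
  · have h2 := hI (s - 1) (by omega) (by omega)
    have := hlow _ (hA (s - 2) (by omega))
    omega
  · have h2 := hI (s + 1) (by omega) h1
    have := hhigh _ (hB (by omega))
    omega

/-- Every even set other than `M` is the union of a block system whose limit vector lies on the
hyperplane of the pair. -/
theorem exists_blockSystem (h : IsFacetPair n M V) {S : Finset ℕ} (hS : S ⊆ Finset.Icc 1 n)
    (hev : IsEvenSet S) (hSM : S ≠ M) :
    ∃ 𝓑 : BlockSystem n, 𝓑.blocks.biUnion id = S ∧ facetForm n M V 𝓑.limitVector = 0 := by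
  have hmem : ∀ (𝓑 : BlockSystem n), 𝓑.blocks.biUnion id = S → ∀ B ∈ 𝓑.blocks, B ⊆ S :=
    fun 𝓑 hU B hB i hi => hU ▸ Finset.mem_biUnion.2 ⟨B, hB, hi⟩
  by_cases hMS : M ⊆ S
  swap
  · obtain ⟨m, hm, hmS⟩ := Finset.not_subset.1 hMS
    obtain ⟨𝓑, hU, -⟩ := hev.exists_maxIntervalSystem hS
    exact ⟨𝓑, hU, 𝓑.facetForm_limitVector_eq_zero_of_mem h.subset h.subset_range hm
      fun B hB hmB => absurd (hmem 𝓑 hU B hB hmB) hmS⟩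
  by_cases hSV : S ⊆ V
  · obtain ⟨D, hD⟩ := hev.exists_isDominoSet
    obtain ⟨𝓑, hU, hblk⟩ := hD.exists_dominoSystem hS
    obtain ⟨s, hs, hsM⟩ : ∃ s ∈ S, s ∉ M := by
      by_contra hno
      push Not at hno
      exact hSM (Finset.Subset.antisymm hno hMS)
    obtain ⟨d, hd, hdM⟩ : ∃ d ∈ D, d ∉ M := by
      rcases hD.cover s hs with h1 | ⟨d, hd, rfl⟩
      · exact ⟨s, h1, hsM⟩
      · exact ⟨d, hd, fun h1 => hsM ((h.mem_iff_succ_mem hMS hSV hD hd).1 h1)⟩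
    refine ⟨𝓑, hU, 𝓑.facetForm_limitVector_eq_zero_of_disjoint h.subset h.subset_range
      (hblk d hd) ((hmem 𝓑 hU _ (hblk d hd)).trans hSV) ?_⟩
    rw [Finset.disjoint_right]
    intro i hi
    rw [Finset.mem_Icc] at hi
    obtain rfl | rfl : i = d ∨ i = d + 1 := by omega
    · exact hdM
    · exact fun h1 => hdM ((h.mem_iff_succ_mem hMS hSV hD hd).2 h1)
  · obtain ⟨s, hs, hsV⟩ := Finset.not_subset.1 hSV
    obtain ⟨c, d, hcd, h1, h2⟩ := exists_isMaxInterval hs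
    obtain ⟨m, hm, h3, h4⟩ := h.exists_mem_of_not_subset hS hev hMS hcd h1 h2 hsV
    obtain ⟨𝓑, hU, hblk⟩ := hev.exists_maxIntervalSystem hS
    refine ⟨𝓑, hU, 𝓑.facetForm_limitVector_eq_zero_of_mem h.subset h.subset_range hm ?_⟩
    intro B hB hmB hBV
    obtain ⟨a, b, hab, rfl⟩ := hblk B hB
    obtain ⟨rfl, rfl⟩ := hab.eq_of_mem hcd (Finset.mem_Icc.1 hmB) ⟨h3, h4⟩
    exact hsV (hBV (Finset.mem_Icc.2 ⟨h1, h2⟩))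

theorem isEvenSet_union_pair (h : IsFacetPair n M V) {w : ℕ} (h1 : w ∉ M) (h2 : w + 1 ∉ M) :
    IsEvenSet (M ∪ Finset.Icc w (w + 1)) := by
  have hM := h.isDominoSet
  refine IsDominoSet.isEvenSet (D := insert w (M.filter (· + 1 ∈ M))) ⟨?_, ?_, ?_, ?_⟩
  · intro d hd
    rcases Finset.mem_insert.1 hd with rfl | hd
    · simp
    · exact Finset.mem_union_left _ (hM.mem d hd)
  · intro d hd
    rcases Finset.mem_insert.1 hd with rfl | hd
    · simp
    · exact Finset.mem_union_left _ (hM.succ_mem d hd)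
  · intro d hd hd'
    rcases Finset.mem_insert.1 hd with rfl | hd <;> rcases Finset.mem_insert.1 hd' with h3 | hd'
    · omega
    · exact h2 (hM.mem _ hd')
    · exact h1 (h3 ▸ hM.succ_mem d hd)
    · exact hM.succ_notMem d hd hd'
  · intro m hm
    rcases Finset.mem_union.1 hm with hm | hm
    · rcases hM.cover m hm with h3 | ⟨d, hd, rfl⟩
      · exact Or.inl (Finset.mem_insert_of_mem h3)
      · exact Or.inr ⟨d, Finset.mem_insert_of_mem hd, rfl⟩
    · rw [Finset.mem_Icc] at hm
      obtain rfl | rfl : m = w ∨ m = w + 1 := by omega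
      · exact Or.inl (Finset.mem_insert_self _ _)
      · exact Or.inr ⟨w, Finset.mem_insert_self _ _, rfl⟩

/-- The set `V` is the union of the even sets between `M` and `V`. -/
theorem exists_isEvenSet_mem (h : IsFacetPair n M V) (ht : AvoidsTriples M V) {v : ℕ}
    (hv : v ∈ V) : ∃ Q, IsEvenSet Q ∧ M ⊆ Q ∧ Q ⊆ V ∧ v ∈ Q := by
  by_cases hvM : v ∈ M
  · exact ⟨M, h.isDominoSet.isEvenSet, subset_rfl, h.subset, hvM⟩
  obtain ⟨a, b, hab, h1, h2⟩ := exists_isMaxInterval hv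
  have hcard := h.two_le_card a b hab
  rw [Nat.card_Icc] at hcard
  have hmem : ∀ t, a ≤ t → t ≤ b → (t ∈ M ↔ t ∈ M ∩ Finset.Icc a b) := by
    intro t h3 h4
    rw [Finset.mem_inter, Finset.mem_Icc]
    tauto
  have htriple : M ∩ Finset.Icc a b ≠ ∅ → b ≠ a + 2 := by
    rintro h3 rfl
    exact h3 (ht a hab)
  obtain ⟨w, h3, h4, h5, h6, h7⟩ : ∃ w, a ≤ w ∧ w + 1 ≤ b ∧ (v = w ∨ v = w + 1) ∧
      w ∉ M ∧ w + 1 ∉ M := by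
    rw [hmem v h1 h2] at hvM
    rcases h.inter a b hab with hM | hM | hM
    · obtain ⟨w, h3, h4, h5⟩ : ∃ w, a ≤ w ∧ w + 1 ≤ b ∧ (v = w ∨ v = w + 1) := by
        rcases h2.eq_or_lt with h6 | h6
        · exact ⟨b - 1, by omega, by omega, by omega⟩
        · exact ⟨v, h1, h6, Or.inl rfl⟩
      refine ⟨w, h3, h4, h5, ?_, ?_⟩ <;> rw [hmem _ (by omega) (by omega), hM] <;> simp
    · have hne := htriple (by rw [hM]; simp)
      rw [hM, Finset.mem_Icc] at hvM
      obtain ⟨w, h3, h4, h5⟩ : ∃ w, a + 2 ≤ w ∧ w + 1 ≤ b ∧ (v = w ∨ v = w + 1) := by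
        rcases h2.eq_or_lt with h6 | h6
        · exact ⟨b - 1, by omega, by omega, by omega⟩
        · exact ⟨v, by omega, h6, Or.inl rfl⟩
      refine ⟨w, by omega, h4, h5, ?_, ?_⟩ <;>
        rw [hmem _ (by omega) (by omega), hM, Finset.mem_Icc] <;> omega
    · have hne := htriple (by rw [hM]; simp)
      rw [hM, Finset.mem_Icc] at hvM
      obtain ⟨w, h3, h4, h5⟩ : ∃ w, a ≤ w ∧ w + 1 + 2 ≤ b ∧ (v = w ∨ v = w + 1) := by
        rcases h1.eq_or_lt with h6 | h6
        · exact ⟨a, by omega, by omega, by omega⟩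
        · exact ⟨v - 1, by omega, by omega, by omega⟩
      refine ⟨w, by omega, by omega, h5, ?_, ?_⟩ <;>
        rw [hmem _ (by omega) (by omega), hM, Finset.mem_Icc] <;> omega
  refine ⟨M ∪ Finset.Icc w (w + 1), h.isEvenSet_union_pair h6 h7, Finset.subset_union_left,
    Finset.union_subset h.subset fun t ht => ?_, Finset.mem_union_right _ ?_⟩
  · rw [Finset.mem_Icc] at ht
    exact hab.2.1 (Finset.mem_Icc.2 ⟨by omega, by omega⟩)
  · rw [Finset.mem_Icc]
    omega

end IsFacetPair

/-! ### The facets -/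

theorem eulerianCone_convex (n : ℕ) : Convex ℝ (eulerianCone n) := by
  refine Convex.closure fun x hx y hy a b ha hb _ => ?_
  exact Submodule.add_mem _ (PointedCone.smul_mem _ ha hx) (PointedCone.smul_mem _ hb hy)

theorem zero_mem_eulerianCone (n : ℕ) : (0 : FlagSpace n) ∈ eulerianCone n :=
  subset_closure (Submodule.zero_mem _)

theorem vectorSpan_eq_span {E : Type*} [AddCommGroup E] [Module ℝ E] {s : Set E}
    (h : (0 : E) ∈ s) : vectorSpan ℝ s = Submodule.span ℝ s := by
  rw [vectorSpan_eq_span_vsub_set_right ℝ h]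
  simp

theorem span_eulerianCone (n : ℕ) : Submodule.span ℝ (eulerianCone n) = evenSpace n := by
  refine le_antisymm (Submodule.span_le.2 (eulerianCone_subset_evenSpace n))
    (evenSpace_le_of_triangular _ fun S hS hev => ?_)
  obtain ⟨𝓑, rfl, -⟩ := hev.exists_maxIntervalSystem hS
  exact ⟨𝓑.limitVector, Submodule.subset_span 𝓑.limitVector_mem_eulerianCone,
    eulerianCone_subset_evenSpace n 𝓑.limitVector_mem_eulerianCone,
    𝓑.flagL_limitVector_ne_zero, fun Q => 𝓑.flagL_limitVector_eq_zero⟩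

namespace IsFacetPair

variable {n : ℕ} {M V : Finset ℕ}

theorem facetForm_flagVector_nonneg (h : IsFacetPair n M V)
    {P : Type*} [PartialOrder P] [Fintype P] [BoundedOrder P] [GradeMinOrder ℕ P]
    (hP : grade ℕ (⊤ : P) = n + 1) (hE : IsEulerian P) :
    0 ≤ facetForm n M V (flagVector n P) := by
  rw [facetForm_eq_wordForm h.subset h.subset_range]
  exact h.wordForm_nonneg hP hE

theorem facetForm_nonneg (h : IsFacetPair n M V) {x : FlagSpace n} (hx : x ∈ eulerianCone n) :
    0 ≤ facetForm n M V x := by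
  rw [← facetFormLM_apply h.subset h.subset_range]
  have hclosed : IsClosed {x | 0 ≤ facetFormLM n M V x} :=
    isClosed_le continuous_const (LinearMap.continuous_of_finiteDimensional _)
  refine closure_minimal ?_ hclosed hx
  intro y hy
  induction hy using Submodule.span_induction with
  | mem y hy =>
    obtain ⟨P, _, _, _, _, hP, hE, rfl⟩ := hy
    have := h.facetForm_flagVector_nonneg hP hE
    rwa [← facetFormLM_apply h.subset h.subset_range] at this
  | zero => simp
  | add y z _ _ hy hz =>
    simp only [Set.mem_ofPred_eq, map_add] at *
    exact add_nonneg hy hz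
  | smul c y _ hy =>
    simp only [Set.mem_ofPred_eq] at *
    have : facetFormLM n M V (c • y) = (c : ℝ) * facetFormLM n M V y :=
      (facetFormLM n M V).map_smul (c : ℝ) y
    rw [this]
    exact mul_nonneg c.2 hy

theorem facetForm_dualVector_self_ne_zero (h : IsFacetPair n M V) :
    facetForm n M V (dualVector n M) ≠ 0 := by
  rw [facetForm_dualVector h.subset h.subset_range (h.subset.trans h.subset_range),
    if_pos ⟨subset_rfl, h.subset⟩]
  simp

theorem dualVector_self_mem_evenSpace (h : IsFacetPair n M V) :
    dualVector n M ∈ evenSpace n :=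
  Submodule.subset_span ⟨M, ⟨h.subset.trans h.subset_range, h.isDominoSet.isEvenSet⟩, rfl⟩

/-- The limit vectors attached to the even sets other than `M` lie in the facet, and together with
one further vector they span the span of the cone. -/
theorem span_facetOf (h : IsFacetPair n M V) :
    Submodule.span ℝ (facetOf n M V) = evenSpace n ⊓ LinearMap.ker (facetFormLM n M V) := by
  have hker : ∀ x, facetForm n M V x = facetFormLM n M V x := fun x =>
    (facetFormLM_apply h.subset h.subset_range x).symm
  have hle : Submodule.span ℝ (facetOf n M V) ≤
      evenSpace n ⊓ LinearMap.ker (facetFormLM n M V) := by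
    refine Submodule.span_le.2 fun x hx => ⟨eulerianCone_subset_evenSpace n hx.1, ?_⟩
    rw [SetLike.mem_coe, LinearMap.mem_ker, ← hker]
    exact hx.2
  refine le_antisymm hle ?_
  have hMn := h.subset.trans h.subset_range
  obtain ⟨𝓜, hM, -⟩ := h.isDominoSet.isEvenSet.exists_maxIntervalSystem hMn
  have hsup : evenSpace n ≤
      Submodule.span ℝ (facetOf n M V) ⊔ Submodule.span ℝ {𝓜.limitVector} := by
    refine evenSpace_le_of_triangular _ fun S hS hev => ?_
    by_cases hSM : S = M
    · subst hSM
      refine ⟨𝓜.limitVector, Submodule.mem_sup_right (Submodule.mem_span_singleton_self _),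
        eulerianCone_subset_evenSpace n 𝓜.limitVector_mem_eulerianCone, ?_, ?_⟩
      · have := 𝓜.flagL_limitVector_ne_zero
        rwa [hM] at this
      · exact fun Q hQ hQS => 𝓜.flagL_limitVector_eq_zero hQ (by rwa [hM])
    · obtain ⟨𝓑, rfl, h0⟩ := h.exists_blockSystem hS hev hSM
      exact ⟨𝓑.limitVector, Submodule.mem_sup_left (Submodule.subset_span
        ⟨𝓑.limitVector_mem_eulerianCone, h0⟩),
        eulerianCone_subset_evenSpace n 𝓑.limitVector_mem_eulerianCone,
        𝓑.flagL_limitVector_ne_zero, fun Q => 𝓑.flagL_limitVector_eq_zero⟩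
  have hMne : facetFormLM n M V 𝓜.limitVector ≠ 0 := by
    intro h0
    have h1 : 𝓜.limitVector ∈ facetOf n M V :=
      ⟨𝓜.limitVector_mem_eulerianCone, (hker _).trans h0⟩
    have h2 : evenSpace n ≤ Submodule.span ℝ (facetOf n M V) :=
      hsup.trans (sup_le le_rfl ((Submodule.span_singleton_le_iff_mem _ _).2
        (Submodule.subset_span h1)))
    have h3 := (hle (h2 h.dualVector_self_mem_evenSpace)).2
    rw [SetLike.mem_coe, LinearMap.mem_ker, ← hker] at h3
    exact h.facetForm_dualVector_self_ne_zero h3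
  rintro x ⟨hxE, hx0⟩
  obtain ⟨y, hy, z, hz, rfl⟩ := Submodule.mem_sup.1 (hsup hxE)
  obtain ⟨t, rfl⟩ := Submodule.mem_span_singleton.1 hz
  have hy0 : facetFormLM n M V y = 0 := (hle hy).2
  rw [SetLike.mem_coe, LinearMap.mem_ker, map_add, hy0, zero_add, map_smul, smul_eq_mul] at hx0
  rw [(mul_eq_zero.1 hx0).resolve_right hMne, zero_smul, add_zero]
  exact hy

theorem isFacet (h : IsFacetPair n M V) : IsFacet (eulerianCone n) (facetOf n M V) := by
  have hker : ∀ x, facetForm n M V x = facetFormLM n M V x := fun x =>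
    (facetFormLM_apply h.subset h.subset_range x).symm
  have hzero : (0 : FlagSpace n) ∈ facetOf n M V :=
    ⟨zero_mem_eulerianCone n, by rw [hker, map_zero]⟩
  refine ⟨⟨0, hzero⟩, ?_, ⟨fun x hx => hx.1, ?_⟩, ?_⟩
  · intro x hx y hy a b ha hb hab
    refine ⟨eulerianCone_convex n hx.1 hy.1 ha hb hab, ?_⟩
    have h1 := hx.2
    have h2 := hy.2
    rw [hker] at h1 h2 ⊢
    rw [map_add, map_smul, map_smul, h1, h2]
    simp
  · rintro x hx y hy z hz ⟨a, b, ha, hb, -, rfl⟩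
    refine ⟨hx, ?_⟩
    have h1 := h.facetForm_nonneg hx
    have h2 := h.facetForm_nonneg hy
    have h3 := hz.2
    rw [hker] at h1 h2 h3 ⊢
    rw [map_add, map_smul, map_smul, smul_eq_mul, smul_eq_mul] at h3
    have h4 := mul_nonneg ha.le h1
    have h5 := mul_nonneg hb.le h2
    exact (mul_eq_zero.1 (by linarith : a * facetFormLM n M V x = 0)).resolve_left ha.ne'
  · rw [vectorSpan_eq_span hzero, vectorSpan_eq_span (zero_mem_eulerianCone n), h.span_facetOf,
      span_eulerianCone]
    have hne : (facetFormLM n M V).domRestrict (evenSpace n) ≠ 0 := by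
      intro h0
      have h1 := LinearMap.congr_fun h0 ⟨dualVector n M, h.dualVector_self_mem_evenSpace⟩
      rw [LinearMap.domRestrict_apply, ← hker] at h1
      exact h.facetForm_dualVector_self_ne_zero h1
    rw [← Module.Dual.finrank_ker_add_one_of_ne_zero hne, LinearMap.ker_domRestrict,
      ← Submodule.finrank_map_subtype_eq, Submodule.map_comap_subtype]

/-- An even set lies between `M` and `V` exactly if its dual vector does not lie on the hyperplane
of the pair, so that the facet determines these sets. -/
theorem between_iff_notMem_span (h : IsFacetPair n M V) {Q : Finset ℕ}
    (hQ : Q ⊆ Finset.Icc 1 n) (hev : IsEvenSet Q) :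
    M ⊆ Q ∧ Q ⊆ V ↔ dualVector n Q ∉ Submodule.span ℝ (facetOf n M V) := by
  have hmem : dualVector n Q ∈ evenSpace n := Submodule.subset_span ⟨Q, ⟨hQ, hev⟩, rfl⟩
  rw [h.span_facetOf, Submodule.mem_inf, LinearMap.mem_ker,
    facetFormLM_apply h.subset h.subset_range, facetForm_dualVector h.subset h.subset_range hQ]
  split_ifs with h1 <;> simp [hmem, h1]

theorem subset_of_facetOf_eq (h : IsFacetPair n M V) {M' V' : Finset ℕ}
    (h' : IsFacetPair n M' V') (ht : AvoidsTriples M V) (heq : facetOf n M V = facetOf n M' V') :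
    M' ⊆ M ∧ V ⊆ V' := by
  have key : ∀ Q, IsEvenSet Q → M ⊆ Q → Q ⊆ V → M' ⊆ Q ∧ Q ⊆ V' := by
    intro Q hev h1 h2
    have hQ := h2.trans h.subset_range
    rw [h'.between_iff_notMem_span hQ hev, ← heq, ← h.between_iff_notMem_span hQ hev]
    exact ⟨h1, h2⟩
  refine ⟨(key M h.isDominoSet.isEvenSet subset_rfl h.subset).1, fun v hv => ?_⟩
  obtain ⟨Q, hev, h1, h2, hvQ⟩ := h.exists_isEvenSet_mem ht hv
  exact (key Q hev h1 h2).2 hvQ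

end IsFacetPair

theorem mainTheorem2 (n : ℕ) :
    (∀ M V : Finset ℕ, IsFacetPair n M V →
      (∀ (P : Type*) [PartialOrder P] [Fintype P] [BoundedOrder P] [GradeMinOrder ℕ P],
        grade ℕ (⊤ : P) = n + 1 → IsEulerian P → 0 ≤ facetForm n M V (flagVector n P)) ∧
      (∀ x ∈ eulerianCone n, 0 ≤ facetForm n M V x) ∧
      IsFacet (eulerianCone n) (facetOf n M V)) ∧
    (∀ M V M' V' : Finset ℕ,
      IsFacetPair n M V → AvoidsTriples M V →
      IsFacetPair n M' V' → AvoidsTriples M' V' →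
      (M, V) ≠ (M', V') → facetOf n M V ≠ facetOf n M' V') := by
  refine ⟨fun M V h => ⟨fun P _ _ _ _ hP hE => h.facetForm_flagVector_nonneg hP hE,
    fun x hx => h.facetForm_nonneg hx, h.isFacet⟩, fun M V M' V' h ht h' ht' hne heq => hne ?_⟩
  have h1 := h.subset_of_facetOf_eq h' ht heq
  have h2 := h'.subset_of_facetOf_eq h ht' heq.symm
  rw [h1.1.antisymm' h2.1, h1.2.antisymm h2.2]
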